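/- **Theorem (well-posedness).** Let $\rho_1,\rho_2,k_1,k_2,k_3,l,L,d_0>0$ and $0<\alpha<\beta<L$ be real numbers, and let $d(x)=d_0$ for $x\in(\alpha,\beta)$ and $d(x)=0$ for $x\in(0,\alpha)\cup(\beta,L)$. All functions are complex valued and derivatives in $x$ are weak derivatives. Let $\mathcal H=\left(H^1_0(0,L)\times L^2(0,L)\right)^3$, with elements $U=(v^1,\dots,v^6)$ and with the inner product $$(U,\widetilde U)_{\mathcal H}=\int_0^L\Big\{k_1(v^1_x+v^3+lv^5)\overline{(\widetilde v^1_x+\widetilde v^3+l\widetilde v^5)}+\rho_1v^2\overline{\widetilde v^2}+k_2v^3_x\overline{\widetilde v^3_x}+\rho_2v^4\overline{\widetilde v^4}+k_3(v^5_x-lv^1)\overline{(\widetilde v^5_x-l\widetilde v^1)}+\rho_1v^6\overline{\widetilde v^6}\Big\}\,dx .$$ Let $\mathcal A:D(\mathcal A)\subset\mathcal H\to\mathcal H$ be the operator with domain $$D(\mathcal A)=\Big\{U\in\mathcal H:\ v^1,v^3\in H^2(0,L)\cap H^1_0(0,L),\ v^2,v^4,v^6\in H^1_0(0,L),\ \big[k_3v^5_x+d(x)(v^6_x-lv^2)\big]_x\in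 L^2(0,L)\Big\}$$ given by $$\mathcal AU=\begin{pmatrix}v^2\\ \frac{k_1}{\rho_1}(v^1_x+v^3+lv^5)_x+\frac{lk_3}{\rho_1}(v^5_x-lv^1)+\frac{l\,d(x)}{\rho_1}(v^6_x-lv^2)\\ v^4\\ \frac{k_2}{\rho_2}v^3_{xx}-\frac{k_1}{\rho_2}(v^1_x+v^3+lv^5)\\ v^6\\ \frac1{\rho_1}\big[k_3(v^5_x-lv^1)+d(x)(v^6_x-lv^2)\big]_x-\frac{lk_1}{\rho_1}(v^1_x+v^3+lv^5)\end{pmatrix}.$$ Then $\mathcal A$ generates a $C_0$-semigroup of contractions $(e^{t\mathcal A})_{t\ge0}$ on $\mathcal H$. For every $U_0\in\mathcal H$ the problem $$U_t=\mathcal AU,\qquad U(0)=U_0,$$ has a unique weak solution, namely $U(t)=e^{t\mathcal A}U_0\in C^0(\mathbb R^+,\mathcal H)$. Here a weak solution is a function $U\in C^0([0,\infty),\mathcal H)$ with $U(0)=U_0$ such that, for every $V\in D(\mathcal A^*)$, the function $t\mapsto(U(t),V)_{\mathcal H}$ is absolutely continuous on every interval $[0,T]$ and satisfies $\frac{d}{dt}(U(t),V)_{\mathcal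 H}=(U(t),\mathcal A^*V)_{\mathcal H}$ for almost every $t>0$. Moreover, if $U_0\in D(\mathcal A)$, then the problem has a unique strong solution, namely $U(t)=e^{t\mathcal A}U_0\in C^0(\mathbb R^+,D(\mathcal A))\cap C^1(\mathbb R^+,\mathcal H)$, where $D(\mathcal A)$ carries the graph norm. Here a strong solution is a function $U$ in this class with $U(0)=U_0$ and $U_t(t)=\mathcal AU(t)$ for all $t\ge0$. -/

import Mathlib

open MeasureTheory Set Filter Topology
open scoped ContDiff NNReal ComplexConjugate

noncomputable section

namespace Bresse

/-- Lebesgue measure on the interval `(0, L)`. -/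
abbrev vol (L : ℝ) : Measure ℝ := volume.restrict (Ioo 0 L)

/-- The complex Hilbert space `L²(0, L)`. -/
abbrev L2 (L : ℝ) : Type := Lp ℂ 2 (vol L)

/-- Test functions on `(0, L)`: complex valued, smooth, compactly supported in `(0, L)`. -/
structure IsTest (L : ℝ) (φ : ℝ → ℂ) : Prop where
  smooth : ContDiff ℝ ∞ φ
  compact : HasCompactSupport φ
  supp : tsupport φ ⊆ Ioo 0 L

/-- `g` is the weak derivative of `u` on `(0, L)`. -/
def IsWeakDeriv (L : ℝ) (u g : L2 L) : Prop :=
  ∀ φ : ℝ → ℂ, IsTest L φ → ∫ x in Ioo 0 L, u x * deriv φ x = -∫ x in Ioo 0 L, g x * φ x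

/-! ### Basic facts on weak derivatives -/

theorem memLp_of_continuous (L : ℝ) {f : ℝ → ℂ} (hf : Continuous f) : MemLp f 2 (vol L) := by
  obtain ⟨C, hC⟩ := (isCompact_Icc (a := (0 : ℝ)) (b := L)).exists_bound_of_continuousOn
    hf.continuousOn
  refine MemLp.of_bound hf.aestronglyMeasurable C ?_
  filter_upwards [ae_restrict_mem measurableSet_Ioo] with x hx
  exact hC x (Ioo_subset_Icc_self hx)

theorem integral_mul_eq_inner {L : ℝ} (u : L2 L) {f : ℝ → ℂ} (hf : Continuous f) :
    ∫ x in Ioo 0 L, u x * f x =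
      inner ℂ ((memLp_of_continuous L (Complex.continuous_conj.comp hf)).toLp _) u := by
  rw [L2.inner_def]
  refine integral_congr_ae ?_
  filter_upwards [(memLp_of_continuous L (Complex.continuous_conj.comp hf)).coeFn_toLp] with x hx
  rw [hx]
  simp [RCLike.inner_apply]

theorem IsTest.deriv_continuous {L : ℝ} {φ : ℝ → ℂ} (h : IsTest L φ) : Continuous (deriv φ) :=
  h.smooth.continuous_deriv (by simp)

theorem IsTest.eq_zero {L : ℝ} {φ : ℝ → ℂ} (h : IsTest L φ) {x : ℝ} (hx : x ∉ Ioo 0 L) :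
    φ x = 0 := by
  by_contra hne
  exact hx (h.supp (subset_tsupport _ hne))

theorem isTest_add {L : ℝ} {φ ψ : ℝ → ℂ} (h : IsTest L φ) (h' : IsTest L ψ) :
    IsTest L (φ + ψ) :=
  ⟨h.smooth.add h'.smooth, h.compact.add h'.compact,
    (tsupport_add φ ψ).trans (union_subset h.supp h'.supp)⟩

theorem isTest_smul {L : ℝ} {φ : ℝ → ℂ} (c : ℂ) (h : IsTest L φ) : IsTest L (c • φ) := by
  have hs : tsupport (c • φ) ⊆ tsupport φ :=
    closure_mono (Function.support_const_smul_subset c φ)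
  exact ⟨contDiff_const.smul h.smooth, h.compact.of_isClosed_subset (isClosed_tsupport _) hs,
    hs.trans h.supp⟩

theorem isTest_zero (L : ℝ) : IsTest L 0 := by
  have := contDiff_const (𝕜 := ℝ) (E := ℝ) (n := ∞) (c := (0 : ℂ))
  exact ⟨this, HasCompactSupport.zero, by simp⟩

theorem isWeakDeriv_iff {L : ℝ} {u g : L2 L} : IsWeakDeriv L u g ↔
    ∀ φ : ℝ → ℂ, ∀ h : IsTest L φ,
      inner ℂ ((memLp_of_continuous L (Complex.continuous_conj.comp h.deriv_continuous)).toLp _) u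
      + inner ℂ ((memLp_of_continuous L
        (Complex.continuous_conj.comp h.smooth.continuous)).toLp _) g = 0 := by
  refine forall_congr' fun φ => forall_congr' fun h => ?_
  rw [integral_mul_eq_inner u h.deriv_continuous, integral_mul_eq_inner g h.smooth.continuous,
    eq_neg_iff_add_eq_zero]

theorem eq_zero_of_forall_test {L : ℝ} {u : L2 L}
    (h : ∀ φ : ℝ → ℂ, IsTest L φ → ∫ x in Ioo 0 L, u x * φ x = 0) : u = 0 := by
  have hloc : LocallyIntegrableOn (fun x => u x) (Ioo 0 L) volume := by
    have : IntegrableOn (fun x => u x) (Ioo 0 L) volume :=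
      (Lp.memLp u).integrable (by norm_num)
    exact this.locallyIntegrableOn
  have key := isOpen_Ioo.ae_eq_zero_of_integral_contDiff_smul_eq_zero hloc (fun g hg hc hs => by
    have ht : IsTest L (fun x => (g x : ℂ)) := by
      have hs' : tsupport (fun x => (g x : ℂ)) ⊆ tsupport g := by
        refine closure_mono fun x hx => ?_
        intro h0
        exact hx (by simp [h0])
      exact ⟨Complex.ofRealCLM.contDiff.comp hg,
        hc.of_isClosed_subset (isClosed_tsupport _) hs', hs'.trans hs⟩
    have h1 := h _ ht
    rw [← setIntegral_eq_integral_of_forall_compl_eq_zero (s := Ioo 0 L)]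
    · rw [← h1]
      refine integral_congr_ae (Eventually.of_forall fun x => ?_)
      simp [mul_comm]
    · intro x hx
      have : g x = 0 := by
        by_contra hne
        exact hx (hs (subset_tsupport _ hne))
      simp [this])
  rw [Lp.eq_zero_iff_ae_eq_zero]
  exact (ae_restrict_iff' measurableSet_Ioo).2 key

theorem IsWeakDeriv.unique {L : ℝ} {u g g' : L2 L} (h : IsWeakDeriv L u g)
    (h' : IsWeakDeriv L u g') : g = g' := by
  rw [← sub_eq_zero]
  refine eq_zero_of_forall_test fun φ hφ => ?_
  have e1 := isWeakDeriv_iff.1 h φ hφ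
  have e2 := isWeakDeriv_iff.1 h' φ hφ
  rw [integral_mul_eq_inner _ hφ.smooth.continuous, inner_sub_right]
  linear_combination e1 - e2

theorem IsWeakDeriv.add {L : ℝ} {u g u' g' : L2 L} (h : IsWeakDeriv L u g)
    (h' : IsWeakDeriv L u' g') : IsWeakDeriv L (u + u') (g + g') := by
  rw [isWeakDeriv_iff] at *
  intro φ hφ
  rw [inner_add_right, inner_add_right]
  linear_combination h φ hφ + h' φ hφ

theorem IsWeakDeriv.smul {L : ℝ} {u g : L2 L} (c : ℂ) (h : IsWeakDeriv L u g) :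
    IsWeakDeriv L (c • u) (c • g) := by
  rw [isWeakDeriv_iff] at *
  intro φ hφ
  rw [inner_smul_right, inner_smul_right]
  linear_combination c * h φ hφ

theorem isWeakDeriv_zero (L : ℝ) : IsWeakDeriv L 0 0 := by
  rw [isWeakDeriv_iff]
  intro φ hφ
  simp

/-! ### Sobolev spaces on `(0, L)` -/

/-- `H¹(0, L)`: the functions in `L²` that have a weak derivative in `L²`. -/
def H1 (L : ℝ) : Submodule ℂ (L2 L) where
  carrier := {u | ∃ g, IsWeakDeriv L u g}
  add_mem' := by
    rintro u u' ⟨g, h⟩ ⟨g', h'⟩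
    exact ⟨_, h.add h'⟩
  zero_mem' := ⟨0, isWeakDeriv_zero L⟩
  smul_mem' := by
    rintro c u ⟨g, h⟩
    exact ⟨_, h.smul c⟩

open Classical in
/-- The weak derivative `u_x` of `u ∈ H¹(0, L)` (extended by `0` to functions outside `H¹`). -/
def dx {L : ℝ} (u : L2 L) : L2 L :=
  if h : ∃ g, IsWeakDeriv L u g then h.choose else 0

theorem isWeakDeriv_dx {L : ℝ} {u : L2 L} (h : u ∈ H1 L) : IsWeakDeriv L u (dx u) := by
  have h' : ∃ g, IsWeakDeriv L u g := h
  rw [dx, dif_pos h']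
  exact h'.choose_spec

theorem IsWeakDeriv.dx_eq {L : ℝ} {u g : L2 L} (h : IsWeakDeriv L u g) : dx u = g :=
  (isWeakDeriv_dx ⟨g, h⟩).unique h

theorem dx_add {L : ℝ} {u v : L2 L} (hu : u ∈ H1 L) (hv : v ∈ H1 L) :
    dx (u + v) = dx u + dx v :=
  ((isWeakDeriv_dx hu).add (isWeakDeriv_dx hv)).dx_eq

theorem dx_smul {L : ℝ} (c : ℂ) {u : L2 L} (hu : u ∈ H1 L) : dx (c • u) = c • dx u :=
  ((isWeakDeriv_dx hu).smul c).dx_eq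

theorem dx_zero (L : ℝ) : dx (0 : L2 L) = 0 := (isWeakDeriv_zero L).dx_eq

/-- `H²(0, L)`: the functions in `H¹(0, L)` whose weak derivative is in `H¹(0, L)`. -/
def H2 (L : ℝ) : Submodule ℂ (L2 L) where
  carrier := {u | u ∈ H1 L ∧ dx u ∈ H1 L}
  add_mem' := by
    rintro u v ⟨hu, hu'⟩ ⟨hv, hv'⟩
    exact ⟨add_mem hu hv, by rw [dx_add hu hv]; exact add_mem hu' hv'⟩
  zero_mem' := ⟨zero_mem _, by rw [dx_zero]; exact zero_mem _⟩
  smul_mem' := by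
    rintro c u ⟨hu, hu'⟩
    exact ⟨Submodule.smul_mem _ c hu, by rw [dx_smul c hu]; exact Submodule.smul_mem _ c hu'⟩

/-- The pairs `(φ, φ')` in `L² × L²`, where `φ` is a test function on `(0, L)`. -/
def testPairs (L : ℝ) : Submodule ℂ (L2 L × L2 L) where
  carrier := {p | ∃ φ : ℝ → ℂ, IsTest L φ ∧ p.1 =ᵐ[vol L] φ ∧ p.2 =ᵐ[vol L] deriv φ}
  add_mem' := by
    rintro p q ⟨φ, hφ, h1, h2⟩ ⟨ψ, hψ, h3, h4⟩
    refine ⟨φ + ψ, isTest_add hφ hψ, ?_, ?_⟩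
    · exact (Lp.coeFn_add p.1 q.1).trans (h1.add h3)
    · refine (Lp.coeFn_add p.2 q.2).trans ((h2.add h4).trans (Eventually.of_forall fun x => ?_))
      exact (deriv_add (hφ.smooth.differentiable (by simp) x)
        (hψ.smooth.differentiable (by simp) x)).symm
  zero_mem' := by
    refine ⟨0, isTest_zero L, Lp.coeFn_zero _ _ _, ?_⟩
    refine (Lp.coeFn_zero ℂ 2 (vol L)).trans (Eventually.of_forall fun x => ?_)
    exact (deriv_const x (0 : ℂ)).symm
  smul_mem' := by
    rintro c p ⟨φ, hφ, h1, h2⟩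
    refine ⟨c • φ, isTest_smul c hφ, ?_, ?_⟩
    · exact (Lp.coeFn_smul c p.1).trans (h1.const_smul c)
    · refine (Lp.coeFn_smul c p.2).trans ((h2.const_smul c).trans (Eventually.of_forall fun x => ?_))
      exact (deriv_const_smul c (hφ.smooth.differentiable (by simp) x)).symm

/-- `H¹₀(0, L)`: the closure of the test functions in the norm of `H¹(0, L)`, that is, the set of
all `u` such that some `φₙ → u` and `φₙ' → g` in `L²(0, L)`, with test functions `φₙ`. -/
def H10 (L : ℝ) : Submodule ℂ (L2 L) :=
  (testPairs L).topologicalClosure.map (LinearMap.fst ℂ (L2 L) (L2 L))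

theorem integral_closure_testPairs {L : ℝ} (hL : 0 ≤ L) {p : L2 L × L2 L}
    (hp : p ∈ (testPairs L).topologicalClosure) {ψ ψ' : ℝ → ℂ}
    (hψ : ∀ x, HasDerivAt ψ (ψ' x) x) (hc : Continuous ψ') :
    ∫ x in Ioo 0 L, p.1 x * ψ' x = -∫ x in Ioo 0 L, p.2 x * ψ x := by
  have hcψ : Continuous ψ := continuous_iff_continuousAt.2 fun x => (hψ x).continuousAt
  rw [integral_mul_eq_inner _ hc, integral_mul_eq_inner _ hcψ, eq_neg_iff_add_eq_zero]
  refine closure_minimal (s := (testPairs L : Set (L2 L × L2 L))) (t := {p : L2 L × L2 L |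
    inner ℂ ((memLp_of_continuous L (Complex.continuous_conj.comp hc)).toLp _) p.1 +
    inner ℂ ((memLp_of_continuous L (Complex.continuous_conj.comp hcψ)).toLp _) p.2 = 0})
    ?_ ?_ hp
  · rintro q ⟨φ, hφ, h1, h2⟩
    show _ = _
    rw [← integral_mul_eq_inner _ hc, ← integral_mul_eq_inner _ hcψ,
      integral_congr_ae (g := fun x => φ x * ψ' x) (by filter_upwards [h1] with x hx; rw [hx]),
      integral_congr_ae (f := fun x => q.2 x * ψ x) (g := fun x => deriv φ x * ψ x)
        (by filter_upwards [h2] with x hx; rw [hx])]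
    have i1 : Continuous fun x => φ x * ψ' x := hφ.smooth.continuous.mul hc
    have i2 : Continuous fun x => deriv φ x * ψ x := hφ.deriv_continuous.mul hcψ
    rw [← integral_Ioc_eq_integral_Ioo, ← integral_Ioc_eq_integral_Ioo,
      ← intervalIntegral.integral_of_le hL, ← intervalIntegral.integral_of_le hL,
      ← intervalIntegral.integral_add (i1.intervalIntegrable _ _) (i2.intervalIntegrable _ _),
      intervalIntegral.integral_eq_sub_of_hasDerivAt (f := fun x => φ x * ψ x)]
    · rw [hφ.eq_zero (x := L) (by simp), hφ.eq_zero (x := 0) (by simp)]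
      simp
    · intro x _
      have := ((hφ.smooth.differentiable (by simp) x).hasDerivAt).mul (hψ x)
      exact this.congr_deriv (add_comm _ _)
    · exact (i1.add i2).intervalIntegrable _ _
  · refine isClosed_eq ?_ continuous_const
    exact (continuous_const.inner continuous_fst).add (continuous_const.inner continuous_snd)

theorem isWeakDeriv_of_mem_closure {L : ℝ} {p : L2 L × L2 L}
    (hp : p ∈ (testPairs L).topologicalClosure) : IsWeakDeriv L p.1 p.2 := by
  intro φ hφ
  rcases le_or_gt 0 L with hL | hL
  · exact integral_closure_testPairs hL hp
      (fun x => (hφ.smooth.differentiable (by simp) x).hasDerivAt) hφ.deriv_continuous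
  · simp [Ioo_eq_empty (not_lt.2 hL.le)]

theorem H10_le_H1 (L : ℝ) : H10 L ≤ H1 L := by
  rintro u ⟨p, hp, rfl⟩
  exact ⟨p.2, isWeakDeriv_of_mem_closure hp⟩

/-- An element of `H¹₀(0, L)` with `u_x = c u` vanishes. -/
theorem eq_zero_of_dx_eq_smul {L : ℝ} (hL : 0 ≤ L) {u : L2 L} (hu : u ∈ H10 L) {c : ℂ}
    (h : dx u = c • u) : u = 0 := by
  obtain ⟨p, hp, rfl⟩ := hu
  have hp2 : p.2 = c • p.1 := by
    rw [← (isWeakDeriv_of_mem_closure hp).dx_eq]; exact h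
  refine eq_zero_of_forall_test fun η hη => ?_
  have hη' : Continuous η := hη.smooth.continuous
  have he : ∀ (a : ℂ) (x : ℝ), HasDerivAt (fun x : ℝ => Complex.exp (a * x))
      (Complex.exp (a * x) * a) x := fun a x => by
    have := ((Complex.ofRealCLM.hasDerivAt (x := x)).const_mul a).cexp
    simpa using this
  have hint : Continuous fun s : ℝ => Complex.exp (c * s) * η s := by fun_prop
  have hψ : ∀ x : ℝ, HasDerivAt
      (fun x : ℝ => Complex.exp (-c * x) * ∫ s in (0 : ℝ)..x, Complex.exp (c * s) * η s)
      (-c * (Complex.exp (-c * x) * ∫ s in (0 : ℝ)..x, Complex.exp (c * s) * η s) + η x) x := by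
    intro x
    have h1 := (he (-c) x).mul (hint.integral_hasStrictDerivAt 0 x).hasDerivAt
    refine h1.congr_deriv ?_
    have : Complex.exp (-c * x) * Complex.exp (c * x) = 1 := by
      rw [← Complex.exp_add]; simp
    linear_combination η x * this
  set ψ : ℝ → ℂ :=
    fun x : ℝ => Complex.exp (-c * x) * ∫ s in (0 : ℝ)..x, Complex.exp (c * s) * η s with hψd
  have hcψ : Continuous ψ := continuous_iff_continuousAt.2 fun x => (hψ x).continuousAt
  have key := integral_closure_testPairs hL hp hψ (by fun_prop)
  have i1 : Continuous fun x => -c * ψ x + η x := by fun_prop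
  have e1 : ∫ x in Ioo 0 L, p.2 x * ψ x = ∫ x in Ioo 0 L, p.1 x * (c * ψ x) := by
    rw [hp2]
    refine integral_congr_ae ?_
    filter_upwards [Lp.coeFn_smul c p.1] with x hx
    rw [hx]
    simp only [Pi.smul_apply, smul_eq_mul]
    ring
  have hmul : ∀ f : ℝ → ℂ, Continuous f → Integrable (fun x => p.1 x * f x) (vol L) :=
    fun f hf => (Lp.memLp p.1).integrable_mul (memLp_of_continuous L hf)
  have e2 : ∫ x in Ioo 0 L, p.1 x * η x =
      ∫ x in Ioo 0 L, p.1 x * (-c * ψ x + η x) + p.1 x * (c * ψ x) := by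
    refine integral_congr_ae (Eventually.of_forall fun x => ?_)
    simp only
    ring
  show ∫ x in Ioo 0 L, p.1 x * η x = 0
  rw [e2, integral_add (hmul _ i1) (hmul _ (by fun_prop)), ← e1]
  exact eq_neg_iff_add_eq_zero.1 key

/-! ### The Bresse system -/

/-- The physical constants `ρ₁, ρ₂, k₁, k₂, k₃, l, L > 0`, the damped region `(α, β)` with
`0 < α < β < L`, and the damping strength `d₀ > 0`. -/
structure Params where
  (ρ₁ ρ₂ k₁ k₂ k₃ l L α β d₀ : ℝ)
  ρ₁_pos : 0 < ρ₁
  ρ₂_pos : 0 < ρ₂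
  k₁_pos : 0 < k₁
  k₂_pos : 0 < k₂
  k₃_pos : 0 < k₃
  l_pos : 0 < l
  L_pos : 0 < L
  α_pos : 0 < α
  α_lt_β : α < β
  β_lt_L : β < L
  d₀_pos : 0 < d₀

/-- The damping coefficient `d(x)`: equal to `d₀` on `(α, β)` and to `0` elsewhere. -/
def Params.d (P : Params) : ℝ → ℝ := indicator (Ioo P.α P.β) fun _ => P.d₀

theorem memLp_d_mul (P : Params) (u : L2 P.L) :
    MemLp (fun x => (P.d x : ℂ) * u x) 2 (vol P.L) := by
  have h : (fun x => (P.d x : ℂ) * u x) =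
      indicator (Ioo P.α P.β) (fun x => (P.d₀ : ℂ) * u x) := by
    funext x
    by_cases hx : x ∈ Ioo P.α P.β <;> simp [Params.d, hx]
  rw [h]
  exact ((Lp.memLp u).const_mul _).indicator measurableSet_Ioo

/-- Multiplication by `d(x)` on `L²(0, L)`. -/
def Params.dMul (P : Params) : L2 P.L →ₗ[ℂ] L2 P.L where
  toFun u := (memLp_d_mul P u).toLp _
  map_add' u v := by
    rw [← MemLp.toLp_add]
    refine MemLp.toLp_congr _ _ ?_
    filter_upwards [Lp.coeFn_add u v] with x hx
    rw [hx]
    simp [mul_add]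
  map_smul' c u := by
    rw [RingHom.id_apply, ← MemLp.toLp_const_smul]
    refine MemLp.toLp_congr _ _ ?_
    filter_upwards [Lp.coeFn_smul c u] with x hx
    rw [hx]
    simp only [Pi.smul_apply, smul_eq_mul]
    ring

/-- The state space `𝓗 = (H¹₀(0, L) × L²(0, L))³`; it carries the energy inner product below. -/
def State (P : Params) : Type := (H10 P.L × L2 P.L) × (H10 P.L × L2 P.L) × (H10 P.L × L2 P.L)

namespace State

variable {P : Params}

instance : AddCommGroup (State P) :=
  inferInstanceAs (AddCommGroup ((H10 P.L × L2 P.L) × (H10 P.L × L2 P.L) × (H10 P.L × L2 P.L)))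

instance : Module ℂ (State P) :=
  inferInstanceAs (Module ℂ ((H10 P.L × L2 P.L) × (H10 P.L × L2 P.L) × (H10 P.L × L2 P.L)))

/-- The six components `(v¹, …, v⁶)` of a state. -/
def v1 (U : State P) : L2 P.L := U.1.1
def v2 (U : State P) : L2 P.L := U.1.2
def v3 (U : State P) : L2 P.L := U.2.1.1
def v4 (U : State P) : L2 P.L := U.2.1.2
def v5 (U : State P) : L2 P.L := U.2.2.1
def v6 (U : State P) : L2 P.L := U.2.2.2

theorem v1_mem (U : State P) : U.v1 ∈ H10 P.L := U.1.1.2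
theorem v3_mem (U : State P) : U.v3 ∈ H10 P.L := U.2.1.1.2
theorem v5_mem (U : State P) : U.v5 ∈ H10 P.L := U.2.2.1.2

theorem v1_mem_H1 (U : State P) : U.v1 ∈ H1 P.L := H10_le_H1 _ U.v1_mem
theorem v3_mem_H1 (U : State P) : U.v3 ∈ H1 P.L := H10_le_H1 _ U.v3_mem
theorem v5_mem_H1 (U : State P) : U.v5 ∈ H1 P.L := H10_le_H1 _ U.v5_mem

@[simp] theorem v1_add (U V : State P) : (U + V).v1 = U.v1 + V.v1 := rfl
@[simp] theorem v2_add (U V : State P) : (U + V).v2 = U.v2 + V.v2 := rfl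
@[simp] theorem v3_add (U V : State P) : (U + V).v3 = U.v3 + V.v3 := rfl
@[simp] theorem v4_add (U V : State P) : (U + V).v4 = U.v4 + V.v4 := rfl
@[simp] theorem v5_add (U V : State P) : (U + V).v5 = U.v5 + V.v5 := rfl
@[simp] theorem v6_add (U V : State P) : (U + V).v6 = U.v6 + V.v6 := rfl
@[simp] theorem v1_smul (c : ℂ) (U : State P) : (c • U).v1 = c • U.v1 := rfl
@[simp] theorem v2_smul (c : ℂ) (U : State P) : (c • U).v2 = c • U.v2 := rfl
@[simp] theorem v3_smul (c : ℂ) (U : State P) : (c • U).v3 = c • U.v3 := rfl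
@[simp] theorem v4_smul (c : ℂ) (U : State P) : (c • U).v4 = c • U.v4 := rfl
@[simp] theorem v5_smul (c : ℂ) (U : State P) : (c • U).v5 = c • U.v5 := rfl
@[simp] theorem v6_smul (c : ℂ) (U : State P) : (c • U).v6 = c • U.v6 := rfl
@[simp] theorem v1_zero : (0 : State P).v1 = 0 := rfl
@[simp] theorem v2_zero : (0 : State P).v2 = 0 := rfl
@[simp] theorem v3_zero : (0 : State P).v3 = 0 := rfl
@[simp] theorem v4_zero : (0 : State P).v4 = 0 := rfl
@[simp] theorem v5_zero : (0 : State P).v5 = 0 := rfl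
@[simp] theorem v6_zero : (0 : State P).v6 = 0 := rfl

theorem ext {U V : State P} (h1 : U.v1 = V.v1) (h2 : U.v2 = V.v2) (h3 : U.v3 = V.v3)
    (h4 : U.v4 = V.v4) (h5 : U.v5 = V.v5) (h6 : U.v6 = V.v6) : U = V :=
  Prod.ext (Prod.ext (Subtype.ext h1) h2)
    (Prod.ext (Prod.ext (Subtype.ext h3) h4) (Prod.ext (Subtype.ext h5) h6))

/-- The shear strain `v¹_x + v³ + l v⁵`. -/
def shear (U : State P) : L2 P.L := dx U.v1 + U.v3 + (P.l : ℂ) • U.v5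

/-- The axial strain `v⁵_x - l v¹`. -/
def axial (U : State P) : L2 P.L := dx U.v5 - (P.l : ℂ) • U.v1

theorem shear_add (U V : State P) : (U + V).shear = U.shear + V.shear := by
  simp only [shear, v1_add, v3_add, v5_add, dx_add U.v1_mem_H1 V.v1_mem_H1, smul_add]
  abel

theorem shear_smul (c : ℂ) (U : State P) : (c • U).shear = c • U.shear := by
  simp only [shear, v1_smul, v3_smul, v5_smul, dx_smul c U.v1_mem_H1, smul_add,
    smul_comm (P.l : ℂ) c]

theorem axial_add (U V : State P) : (U + V).axial = U.axial + V.axial := by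
  simp only [axial, v1_add, v5_add, dx_add U.v5_mem_H1 V.v5_mem_H1, smul_add]
  abel

theorem axial_smul (c : ℂ) (U : State P) : (c • U).axial = c • U.axial := by
  simp only [axial, v1_smul, v5_smul, dx_smul c U.v5_mem_H1, smul_sub, smul_comm (P.l : ℂ) c]

/-- The energy inner product, conjugate linear in the first argument `U`, linear in `V`:
`∫₀ᴸ k₁ (v¹_x + v³ + l v⁵)~ (…) + ρ₁ v²~ (…) + k₂ v³_x~ (…) + ρ₂ v⁴~ (…) + k₃ (v⁵_x - l v¹)~ (…)
+ ρ₁ v⁶~ (…) dx`, where `~` is complex conjugation. -/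
def energyInner (U V : State P) : ℂ :=
  P.k₁ * inner ℂ U.shear V.shear + P.ρ₁ * inner ℂ U.v2 V.v2 + P.k₂ * inner ℂ (dx U.v3) (dx V.v3)
    + P.ρ₂ * inner ℂ U.v4 V.v4 + P.k₃ * inner ℂ U.axial V.axial + P.ρ₁ * inner ℂ U.v6 V.v6

theorem re_energyInner_self (U : State P) : (energyInner U U).re =
    P.k₁ * ‖U.shear‖ ^ 2 + P.ρ₁ * ‖U.v2‖ ^ 2 + P.k₂ * ‖dx U.v3‖ ^ 2
    + P.ρ₂ * ‖U.v4‖ ^ 2 + P.k₃ * ‖U.axial‖ ^ 2 + P.ρ₁ * ‖U.v6‖ ^ 2 := by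
  have h : ∀ (k : ℝ) (w : L2 P.L), ((k : ℂ) * inner ℂ w w).re = k * ‖w‖ ^ 2 := fun k w => by
    rw [Complex.re_ofReal_mul]
    exact congrArg (k * ·) (inner_self_eq_norm_sq (𝕜 := ℂ) w)
  simp only [energyInner, Complex.add_re, h]

theorem eq_zero_of_energyInner_self (U : State P) (h : energyInner U U = 0) : U = 0 := by
  have h0 : (energyInner U U).re = 0 := by rw [h]; rfl
  rw [re_energyInner_self] at h0
  have a1 := mul_nonneg P.k₁_pos.le (sq_nonneg ‖U.shear‖)
  have a2 := mul_nonneg P.ρ₁_pos.le (sq_nonneg ‖U.v2‖)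
  have a3 := mul_nonneg P.k₂_pos.le (sq_nonneg ‖dx U.v3‖)
  have a4 := mul_nonneg P.ρ₂_pos.le (sq_nonneg ‖U.v4‖)
  have a5 := mul_nonneg P.k₃_pos.le (sq_nonneg ‖U.axial‖)
  have a6 := mul_nonneg P.ρ₁_pos.le (sq_nonneg ‖U.v6‖)
  have z : ∀ (k : ℝ) (w : L2 P.L), 0 < k → k * ‖w‖ ^ 2 = 0 → w = 0 := by
    intro k w hk hw
    have := (mul_eq_zero.1 hw).resolve_left hk.ne'
    simpa using this
  have b1 := z _ _ P.k₁_pos (by linarith : P.k₁ * ‖U.shear‖ ^ 2 = 0)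
  have b2 := z _ _ P.ρ₁_pos (by linarith : P.ρ₁ * ‖U.v2‖ ^ 2 = 0)
  have b3 := z _ _ P.k₂_pos (by linarith : P.k₂ * ‖dx U.v3‖ ^ 2 = 0)
  have b4 := z _ _ P.ρ₂_pos (by linarith : P.ρ₂ * ‖U.v4‖ ^ 2 = 0)
  have b5 := z _ _ P.k₃_pos (by linarith : P.k₃ * ‖U.axial‖ ^ 2 = 0)
  have b6 := z _ _ P.ρ₁_pos (by linarith : P.ρ₁ * ‖U.v6‖ ^ 2 = 0)
  have c3 : U.v3 = 0 := eq_zero_of_dx_eq_smul P.L_pos.le U.v3_mem (c := 0) (by rw [b3, zero_smul])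
  have d1 : dx U.v1 = -((P.l : ℂ) • U.v5) := by
    rw [shear, c3, add_zero] at b1
    exact eq_neg_of_add_eq_zero_left b1
  have d5 : dx U.v5 = (P.l : ℂ) • U.v1 := sub_eq_zero.1 b5
  have hz : ∀ ε : ℂ, ε * ε = -1 → U.v1 + ε • U.v5 = 0 := by
    intro ε hε
    refine eq_zero_of_dx_eq_smul P.L_pos.le (c := ε * P.l)
      (add_mem U.v1_mem (Submodule.smul_mem _ ε U.v5_mem)) ?_
    rw [dx_add U.v1_mem_H1 (Submodule.smul_mem _ ε U.v5_mem_H1), dx_smul ε U.v5_mem_H1, d1, d5,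
      smul_add, smul_smul, smul_smul]
    have : ε * P.l * ε = -P.l := by linear_combination (P.l : ℂ) * hε
    rw [this, neg_smul]
    abel
  have hp := hz Complex.I Complex.I_mul_I
  have hm := hz (-Complex.I) (by simp)
  have c1 : U.v1 = 0 := by
    have h2 : (2 : ℂ) • U.v1 = 0 := by
      have := congrArg₂ (· + ·) hp hm
      simp only [neg_smul, add_zero] at this
      rw [two_smul, ← this]
      abel
    exact (smul_eq_zero.1 h2).resolve_left two_ne_zero
  have c5 : U.v5 = 0 := by
    rw [c1, zero_add] at hp
    exact (smul_eq_zero.1 hp).resolve_left Complex.I_ne_zero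
  exact State.ext c1 b2 c3 b4 c5 b6

/-- The energy inner product is a scalar product on the state space. -/
@[reducible] def innerCore (P : Params) : InnerProductSpace.Core ℂ (State P) where
  inner := energyInner
  conj_inner_symm U V := by simp [energyInner, inner_conj_symm]
  re_inner_nonneg U := by
    show 0 ≤ (energyInner U U).re
    rw [re_energyInner_self]
    have := P.k₁_pos
    have := P.k₂_pos
    have := P.k₃_pos
    have := P.ρ₁_pos
    have := P.ρ₂_pos
    positivity
  add_left U V W := by
    simp only [energyInner, shear_add, axial_add, v2_add, v3_add, v4_add, v6_add,
      dx_add U.v3_mem_H1 V.v3_mem_H1, inner_add_left]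
    ring
  smul_left U V c := by
    simp only [energyInner, shear_smul, axial_smul, v2_smul, v3_smul, v4_smul, v6_smul,
      dx_smul c U.v3_mem_H1, inner_smul_left]
    ring
  definite U h := eq_zero_of_energyInner_self U h

instance : NormedAddCommGroup (State P) :=
  @InnerProductSpace.Core.toNormedAddCommGroup ℂ (State P) _ _ _ (innerCore P)

instance : InnerProductSpace ℂ (State P) :=
  InnerProductSpace.ofCore (innerCore P).toCore

theorem norm_sq_eq (U : State P) : ‖U‖ ^ 2 =
    P.k₁ * ‖U.shear‖ ^ 2 + P.ρ₁ * ‖U.v2‖ ^ 2 + P.k₂ * ‖dx U.v3‖ ^ 2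
    + P.ρ₂ * ‖U.v4‖ ^ 2 + P.k₃ * ‖U.axial‖ ^ 2 + P.ρ₁ * ‖U.v6‖ ^ 2 := by
  rw [← re_energyInner_self]
  exact (inner_self_eq_norm_sq (𝕜 := ℂ) U).symm

theorem inner_eq (U V : State P) : inner ℂ U V = energyInner U V := rfl

/-- The quantity `k₃ v⁵_x + d(x) (v⁶_x - l v²)` in the definition of the domain. -/
def domForce (U : State P) : L2 P.L :=
  (P.k₃ : ℂ) • dx U.v5 + P.dMul (dx U.v6 - (P.l : ℂ) • U.v2)

/-- The axial force `k₃ (v⁵_x - l v¹) + d(x) (v⁶_x - l v²)`. -/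
def force (U : State P) : L2 P.L :=
  (P.k₃ : ℂ) • U.axial + P.dMul (dx U.v6 - (P.l : ℂ) • U.v2)

end State

open State

/-- The domain `D(𝓐)`: `v¹, v³ ∈ H² ∩ H¹₀`, `v², v⁴, v⁶ ∈ H¹₀` and
`[k₃ v⁵_x + d(x) (v⁶_x - l v²)]_x ∈ L²`. -/
structure MemDomain (P : Params) (U : State P) : Prop where
  v1_mem : U.v1 ∈ H2 P.L
  v3_mem : U.v3 ∈ H2 P.L
  v2_mem : U.v2 ∈ H10 P.L
  v4_mem : U.v4 ∈ H10 P.L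
  v6_mem : U.v6 ∈ H10 P.L
  force_mem : U.domForce ∈ H1 P.L

theorem domForce_add {P : Params} {U V : State P} (hU : U.v6 ∈ H10 P.L) (hV : V.v6 ∈ H10 P.L) :
    (U + V).domForce = U.domForce + V.domForce := by
  simp only [domForce, v2_add, v5_add, v6_add, dx_add U.v5_mem_H1 V.v5_mem_H1,
    dx_add (H10_le_H1 _ hU) (H10_le_H1 _ hV), smul_add, map_add, map_sub]
  abel

theorem domForce_smul {P : Params} (c : ℂ) {U : State P} (hU : U.v6 ∈ H10 P.L) :
    (c • U).domForce = c • U.domForce := by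
  simp only [domForce, v2_smul, v5_smul, v6_smul, dx_smul c U.v5_mem_H1,
    dx_smul c (H10_le_H1 _ hU), smul_add, smul_sub, map_sub, map_smul, smul_comm _ c]

/-- `D(𝓐)` as a subspace of the state space. -/
def domain (P : Params) : Submodule ℂ (State P) where
  carrier := {U | MemDomain P U}
  add_mem' := fun {U V} hU hV =>
    ⟨add_mem hU.1 hV.1, add_mem hU.2 hV.2, add_mem hU.3 hV.3, add_mem hU.4 hV.4,
      add_mem hU.5 hV.5, by rw [domForce_add hU.5 hV.5]; exact add_mem hU.6 hV.6⟩
  zero_mem' := ⟨zero_mem _, zero_mem _, zero_mem _, zero_mem _, zero_mem _, by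
    simp only [domForce, v2_zero, v5_zero, v6_zero, dx_zero, smul_zero, sub_zero, map_zero,
      add_zero]
    exact zero_mem _⟩
  smul_mem' := fun c U hU =>
    ⟨Submodule.smul_mem _ c hU.1, Submodule.smul_mem _ c hU.2, Submodule.smul_mem _ c hU.3,
      Submodule.smul_mem _ c hU.4, Submodule.smul_mem _ c hU.5, by
        rw [domForce_smul c hU.5]; exact Submodule.smul_mem _ c hU.6⟩

theorem shear_mem_H1 {P : Params} {U : State P} (hU : MemDomain P U) : U.shear ∈ H1 P.L :=
  add_mem (add_mem hU.v1_mem.2 U.v3_mem_H1) (Submodule.smul_mem _ _ U.v5_mem_H1)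

theorem force_eq {P : Params} (U : State P) :
    U.force = U.domForce - (P.k₃ : ℂ) • (P.l : ℂ) • U.v1 := by
  simp only [force, domForce, axial, smul_sub]
  abel

theorem force_mem_H1 {P : Params} {U : State P} (hU : MemDomain P U) : U.force ∈ H1 P.L := by
  rw [force_eq]
  exact sub_mem hU.force_mem (Submodule.smul_mem _ _ (Submodule.smul_mem _ _ U.v1_mem_H1))

theorem force_add {P : Params} {U V : State P} (hU : MemDomain P U) (hV : MemDomain P V) :
    (U + V).force = U.force + V.force := by
  simp only [force_eq, domForce_add hU.v6_mem hV.v6_mem, v1_add, smul_add]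
  abel

theorem force_smul {P : Params} (c : ℂ) {U : State P} (hU : MemDomain P U) :
    (c • U).force = c • U.force := by
  simp only [force_eq, domForce_smul c hU.v6_mem, v1_smul, smul_sub, smul_comm _ c]

/-- The second component of `𝓐 U`:
`(k₁/ρ₁) (v¹_x + v³ + l v⁵)_x + (l k₃/ρ₁) (v⁵_x - l v¹) + (l d(x)/ρ₁) (v⁶_x - l v²)`. -/
def row2 {P : Params} (U : State P) : L2 P.L :=
  (P.k₁ / P.ρ₁ : ℂ) • dx U.shear + (P.l * P.k₃ / P.ρ₁ : ℂ) • U.axial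
    + (P.l / P.ρ₁ : ℂ) • P.dMul (dx U.v6 - (P.l : ℂ) • U.v2)

/-- The fourth component of `𝓐 U`: `(k₂/ρ₂) v³_xx - (k₁/ρ₂) (v¹_x + v³ + l v⁵)`. -/
def row4 {P : Params} (U : State P) : L2 P.L :=
  (P.k₂ / P.ρ₂ : ℂ) • dx (dx U.v3) - (P.k₁ / P.ρ₂ : ℂ) • U.shear

/-- The sixth component of `𝓐 U`:
`(1/ρ₁) [k₃ (v⁵_x - l v¹) + d(x) (v⁶_x - l v²)]_x - (l k₁/ρ₁) (v¹_x + v³ + l v⁵)`. -/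
def row6 {P : Params} (U : State P) : L2 P.L :=
  (1 / P.ρ₁ : ℂ) • dx U.force - (P.l * P.k₁ / P.ρ₁ : ℂ) • U.shear

theorem row2_add {P : Params} {U V : State P} (hU : MemDomain P U) (hV : MemDomain P V) :
    row2 (U + V) = row2 U + row2 V := by
  simp only [row2, shear_add, axial_add, dx_add (shear_mem_H1 hU) (shear_mem_H1 hV), v2_add,
    v6_add, dx_add (H10_le_H1 _ hU.v6_mem) (H10_le_H1 _ hV.v6_mem), smul_add, smul_sub, map_add,
    map_sub]
  abel

theorem row2_smul {P : Params} (c : ℂ) {U : State P} (hU : MemDomain P U) :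
    row2 (c • U) = c • row2 U := by
  simp only [row2, shear_smul, axial_smul, dx_smul c (shear_mem_H1 hU), v2_smul, v6_smul,
    dx_smul c (H10_le_H1 _ hU.v6_mem), smul_add, smul_sub, map_smul, map_sub, smul_comm _ c]

theorem row4_add {P : Params} {U V : State P} (hU : MemDomain P U) (hV : MemDomain P V) :
    row4 (U + V) = row4 U + row4 V := by
  simp only [row4, shear_add, v3_add, dx_add U.v3_mem_H1 V.v3_mem_H1,
    dx_add hU.v3_mem.2 hV.v3_mem.2, smul_add]
  abel

theorem row4_smul {P : Params} (c : ℂ) {U : State P} (hU : MemDomain P U) :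
    row4 (c • U) = c • row4 U := by
  simp only [row4, shear_smul, v3_smul, dx_smul c U.v3_mem_H1, dx_smul c hU.v3_mem.2, smul_sub,
    smul_comm _ c]

theorem row6_add {P : Params} {U V : State P} (hU : MemDomain P U) (hV : MemDomain P V) :
    row6 (U + V) = row6 U + row6 V := by
  simp only [row6, shear_add, force_add hU hV, dx_add (force_mem_H1 hU) (force_mem_H1 hV),
    smul_add]
  abel

theorem row6_smul {P : Params} (c : ℂ) {U : State P} (hU : MemDomain P U) :
    row6 (c • U) = c • row6 U := by
  simp only [row6, shear_smul, force_smul c hU, dx_smul c (force_mem_H1 hU), smul_sub,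
    smul_comm _ c]

/-- The vector `𝓐 U = (v², row2, v⁴, row4, v⁶, row6)` for `U ∈ D(𝓐)`. -/
def opFun {P : Params} (U : State P) (hU : MemDomain P U) : State P :=
  ((⟨U.v2, hU.v2_mem⟩, row2 U), (⟨U.v4, hU.v4_mem⟩, row4 U), (⟨U.v6, hU.v6_mem⟩, row6 U))

theorem opFun_add {P : Params} {U V : State P} (hU : MemDomain P U) (hV : MemDomain P V)
    (h : MemDomain P (U + V)) : opFun (U + V) h = opFun U hU + opFun V hV := by
  refine State.ext ?_ ?_ ?_ ?_ ?_ ?_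
  · exact v2_add U V
  · exact (row2_add hU hV).trans (v2_add (opFun U hU) (opFun V hV)).symm
  · exact v4_add U V
  · exact (row4_add hU hV).trans (v4_add (opFun U hU) (opFun V hV)).symm
  · exact v6_add U V
  · exact (row6_add hU hV).trans (v6_add (opFun U hU) (opFun V hV)).symm

theorem opFun_smul {P : Params} (c : ℂ) {U : State P} (hU : MemDomain P U)
    (h : MemDomain P (c • U)) : opFun (c • U) h = c • opFun U hU := by
  refine State.ext ?_ ?_ ?_ ?_ ?_ ?_
  · exact v2_smul c U
  · exact (row2_smul c hU).trans (v2_smul c (opFun U hU)).symm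
  · exact v4_smul c U
  · exact (row4_smul c hU).trans (v4_smul c (opFun U hU)).symm
  · exact v6_smul c U
  · exact (row6_smul c hU).trans (v6_smul c (opFun U hU)).symm

/-- The unbounded operator `𝓐 : D(𝓐) ⊆ 𝓗 → 𝓗`. -/
def bresseOp (P : Params) : State P →ₗ.[ℂ] State P where
  domain := domain P
  toFun :=
    { toFun := fun U => opFun (U : State P) U.2
      map_add' := fun U V => opFun_add U.2 V.2 (U + V).2
      map_smul' := fun c U => opFun_smul c U.2 (c • U).2 }

/-! ### Semigroups and solutions of the abstract Cauchy problem `U_t = A U`, `U(0) = U₀` -/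

section Abstract

variable {H : Type*} [NormedAddCommGroup H] [InnerProductSpace ℂ H]

/-- `S` is a `C₀`-semigroup of contractions on `H`. -/
structure IsContractionSemigroup (S : ℝ≥0 → H →L[ℂ] H) : Prop where
  map_zero : S 0 = 1
  map_add : ∀ s t, S (s + t) = S s * S t
  strongly_continuous : ∀ x, Tendsto (fun t => S t x) (𝓝 0) (𝓝 x)
  contraction : ∀ t x, ‖S t x‖ ≤ ‖x‖

/-- `A` is the infinitesimal generator of `S`: `x ∈ D(A)` and `A x = y` if and only if
`(S(t) x - x) / t → y` as `t → 0+`. -/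
def IsGenerator (A : H →ₗ.[ℂ] H) (S : ℝ≥0 → H →L[ℂ] H) : Prop :=
  ∀ x y : H, (∃ h : x ∈ A.domain, A ⟨x, h⟩ = y) ↔
    Tendsto (fun t : ℝ≥0 => ((t : ℝ) : ℂ)⁻¹ • (S t x - x)) (𝓝[>] 0) (𝓝 y)

/-- `V` is in the domain of the adjoint `A*`, and `A* V = W`. -/
def IsAdjointAt (A : H →ₗ.[ℂ] H) (V W : H) : Prop :=
  ∀ X : A.domain, inner ℂ V (A X) = inner ℂ W (X : H)

/-- `U : [0, ∞) → H` is a weak solution of `U_t = A U`, `U(0) = U₀`: it is continuous, and for every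
`V ∈ D(A*)` the function `t ↦ (U(t), V)` is absolutely continuous on every `[0, T]`, with
`d/dt (U(t), V) = (U(t), A* V)` for almost every `t > 0`. Only the values of `U` on `[0, ∞)`
matter. -/
structure IsWeakSolution (A : H →ₗ.[ℂ] H) (U₀ : H) (U : ℝ → H) : Prop where
  continuousOn : ContinuousOn U (Ici 0)
  initial : U 0 = U₀
  absolutelyContinuous : ∀ V W : H, IsAdjointAt A V W → ∀ T : ℝ, 0 < T →
    AbsolutelyContinuousOnInterval (fun t => inner ℂ V (U t)) 0 T
  weak_eq : ∀ V W : H, IsAdjointAt A V W →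
    ∀ᵐ t : ℝ, 0 < t → HasDerivAt (fun s => inner ℂ V (U s)) (inner ℂ W (U t)) t

/-- `U` is a strong solution of `U_t = A U`, `U(0) = U₀`, in the class
`C⁰([0, ∞), D(A)) ∩ C¹([0, ∞), H)`, where `D(A)` carries the graph norm. -/
structure IsStrongSolution (A : H →ₗ.[ℂ] H) (U₀ : H) (U : ℝ → H) : Prop where
  mem_domain : ∀ t : ℝ, 0 ≤ t → U t ∈ A.domain
  continuous_graph : Continuous fun t : Ici (0 : ℝ) => (U t, A ⟨U t, mem_domain t t.2⟩)
  contDiffOn : ContDiffOn ℝ 1 U (Ici 0)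
  initial : U 0 = U₀
  strong_eq : ∀ (t : ℝ) (ht : 0 ≤ t),
    HasDerivWithinAt U (A ⟨U t, mem_domain t ht⟩) (Ici 0) t

end Abstract

end Bresse

end

noncomputable section

namespace Bresse

/-! ### Generation of contraction semigroups by maximal dissipative operators -/

section Generation

variable {H : Type*} [NormedAddCommGroup H] [InnerProductSpace ℂ H]

/-- A curve with `Re (y, y') ≤ 0` has nonincreasing norm. -/
theorem norm_le_of_re_inner_deriv_nonpos {y y' : ℝ → H}
    (hy : ∀ t, 0 ≤ t → HasDerivWithinAt y (y' t) (Ici 0) t)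
    (h : ∀ t, 0 ≤ t → (inner ℂ (y t) (y' t)).re ≤ 0) {t : ℝ} (ht : 0 ≤ t) :
    ‖y t‖ ≤ ‖y 0‖ := by
  have hd : ∀ s, 0 ≤ s → HasDerivWithinAt (fun s => (inner ℂ (y s) (y s)).re)
      (2 * (inner ℂ (y s) (y' s)).re) (Ici 0) s := by
    intro s hs
    have h1 := (hy s hs).inner ℂ (hy s hs)
    have h2 := Complex.reCLM.hasFDerivAt.comp_hasDerivWithinAt s h1
    refine h2.congr_deriv ?_
    have : (inner ℂ (y' s) (y s)).re = (inner ℂ (y s) (y' s)).re := inner_re_symm (𝕜 := ℂ) _ _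
    simp [this]
    ring
  have hanti : AntitoneOn (fun s => (inner ℂ (y s) (y s)).re) (Ici 0) := by
    refine antitoneOn_of_hasDerivWithinAt_nonpos (convex_Ici 0)
      (f' := fun s => 2 * (inner ℂ (y s) (y' s)).re)
      (fun s hs => (hd s hs).continuousWithinAt) (fun s hs => ?_) (fun s hs => ?_)
    · rw [interior_Ici] at hs ⊢
      exact (hd s (le_of_lt hs)).mono Ioi_subset_Ici_self
    · rw [interior_Ici] at hs
      have := h s (le_of_lt hs)
      linarith
  have := hanti (mem_Ici.2 le_rfl) (mem_Ici.2 ht) ht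
  simp only at this
  have e : ∀ x : H, (inner ℂ x x).re = ‖x‖ ^ 2 := fun x => inner_self_eq_norm_sq (𝕜 := ℂ) x
  rw [e, e] at this
  exact (sq_le_sq₀ (norm_nonneg _) (norm_nonneg _)).1 this

/-- `A` is dissipative and `1 - A` maps the domain of `A` onto the whole space. -/
structure IsMaxDissipative (A : H →ₗ.[ℂ] H) : Prop where
  re_inner_nonpos : ∀ x : A.domain, (inner ℂ (x : H) (A x)).re ≤ 0
  exists_sub_eq : ∀ y : H, ∃ x : A.domain, (x : H) - A x = y

/-- The bounded operator `R` is a right inverse of `r - A`. -/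
def IsResolventAt (A : H →ₗ.[ℂ] H) (r : ℝ) (R : H →L[ℂ] H) : Prop :=
  ∀ y : H, ∃ h : R y ∈ A.domain, (r : ℂ) • R y - A ⟨R y, h⟩ = y

variable {A : H →ₗ.[ℂ] H}

theorem re_inner_ofReal_smul (r : ℝ) (x y : H) :
    (inner ℂ x ((r : ℂ) • y)).re = r * (inner ℂ x y).re := by
  rw [inner_smul_right, Complex.re_ofReal_mul]

theorem IsMaxDissipative.mul_norm_le (hA : IsMaxDissipative A) (r : ℝ) (x : A.domain) :
    r * ‖(x : H)‖ ≤ ‖(r : ℂ) • (x : H) - A x‖ := by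
  have h1 : r * ‖(x : H)‖ ^ 2 ≤ (inner ℂ (x : H) ((r : ℂ) • (x : H) - A x)).re := by
    have e : (inner ℂ (x : H) (x : H)).re = ‖(x : H)‖ ^ 2 := inner_self_eq_norm_sq (𝕜 := ℂ) _
    rw [inner_sub_right, Complex.sub_re, re_inner_ofReal_smul, e]
    linarith [hA.re_inner_nonpos x]
  have h2 : (inner ℂ (x : H) ((r : ℂ) • (x : H) - A x)).re ≤
      ‖(x : H)‖ * ‖(r : ℂ) • (x : H) - A x‖ := re_inner_le_norm (𝕜 := ℂ) _ _
  rcases (norm_nonneg (x : H)).eq_or_lt with h | h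
  · rw [← h, mul_zero]
    exact norm_nonneg _
  · refine le_of_mul_le_mul_left ?_ h
    nlinarith

theorem IsMaxDissipative.eq_of_sub_eq (hA : IsMaxDissipative A) {r : ℝ} (hr : 0 < r)
    {x y : A.domain} (h : (r : ℂ) • (x : H) - A x = (r : ℂ) • (y : H) - A y) : x = y := by
  have h1 := hA.mul_norm_le r (x - y)
  have h2 : (r : ℂ) • ((x - y : A.domain) : H) - A (x - y) = 0 := by
    rw [LinearPMap.map_sub, Submodule.coe_sub, smul_sub, ← sub_eq_zero.2 h]
    abel
  rw [h2, norm_zero] at h1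
  have h3 : ‖((x - y : A.domain) : H)‖ = 0 := by
    by_contra hne
    have := mul_pos hr (lt_of_le_of_ne (norm_nonneg _) (Ne.symm hne))
    linarith
  exact sub_eq_zero.1 (Subtype.ext (norm_eq_zero.1 h3))

namespace IsResolventAt

variable {r s : ℝ} {R Q : H →L[ℂ] H}

theorem mem (hR : IsResolventAt A r R) (y : H) : R y ∈ A.domain := (hR y).1

theorem apply_eq (hR : IsResolventAt A r R) (y : H) :
    A ⟨R y, hR.mem y⟩ = (r : ℂ) • R y - y := by
  obtain ⟨h, e⟩ := hR y
  rw [sub_eq_iff_eq_add] at e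
  rw [e]
  abel

theorem apply_sub (hR : IsResolventAt A r R) (hA : IsMaxDissipative A) (hr : 0 < r)
    (x : A.domain) : R ((r : ℂ) • (x : H) - A x) = x := by
  obtain ⟨h, e⟩ := hR ((r : ℂ) • (x : H) - A x)
  exact congrArg Subtype.val (hA.eq_of_sub_eq hr (x := ⟨_, h⟩) (y := x) e)

theorem norm_apply_le (hR : IsResolventAt A r R) (hA : IsMaxDissipative A) (y : H) :
    r * ‖R y‖ ≤ ‖y‖ := by
  obtain ⟨h, e⟩ := hR y
  have := hA.mul_norm_le r ⟨R y, h⟩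
  rwa [e] at this

theorem norm_le (hR : IsResolventAt A r R) (hA : IsMaxDissipative A) (hr : 0 < r) :
    ‖R‖ ≤ r⁻¹ := by
  refine R.opNorm_le_bound (inv_nonneg.2 hr.le) fun y => ?_
  rw [inv_mul_eq_div, le_div_iff₀ hr, mul_comm]
  exact hR.norm_apply_le hA y

theorem sub_eq (hR : IsResolventAt A r R) (hQ : IsResolventAt A s Q) (hA : IsMaxDissipative A)
    (hr : 0 < r) (y : H) : R y - Q y = ((s : ℂ) - r) • R (Q y) := by
  have h1 := hR.apply_sub hA hr ⟨Q y, hQ.mem y⟩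
  rw [hQ.apply_eq y] at h1
  simp only [map_sub, map_smul] at h1
  linear_combination (norm := module) h1

theorem commute (hR : IsResolventAt A r R) (hQ : IsResolventAt A s Q)
    (hA : IsMaxDissipative A) (hr : 0 < r) (hs : 0 < s) : Commute R Q := by
  rcases eq_or_ne s r with rfl | hne
  · have : R = Q := by
      ext y
      have := hR.sub_eq hQ hA hr y
      rwa [sub_self, zero_smul, sub_eq_zero] at this
    rw [this]
  · ext y
    have h1 := hR.sub_eq hQ hA hr y
    have h2 := hQ.sub_eq hR hA hs y
    have h3 : ((s : ℂ) - r) • R (Q y) = ((s : ℂ) - r) • Q (R y) := by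
      rw [← h1, ← neg_sub (r : ℂ) s, neg_smul, ← h2, neg_sub]
    have hne' : (s : ℂ) - r ≠ 0 := sub_ne_zero.2 (by exact_mod_cast hne)
    exact smul_right_injective H hne' h3

/-- Perturbation of the resolvent by a Neumann series. -/
theorem exists_of_lt [CompleteSpace H] (hR : IsResolventAt A r R) (hA : IsMaxDissipative A)
    (hr : 0 < r) (hs : 0 < s) (hsr : s < 2 * r) : ∃ Q : H →L[ℂ] H, IsResolventAt A s Q := by
  have hn : ‖((r : ℂ) - s) • R‖ < 1 := by
    have h1 : ‖(r : ℂ) - s‖ < r := by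
      rw [← Complex.ofReal_sub, Complex.norm_real, Real.norm_eq_abs, abs_lt]
      constructor <;> linarith
    calc ‖((r : ℂ) - s) • R‖ ≤ ‖(r : ℂ) - s‖ * ‖R‖ := norm_smul_le _ _
      _ ≤ ‖(r : ℂ) - s‖ * r⁻¹ := by gcongr; exact hR.norm_le hA hr
      _ < r * r⁻¹ := by gcongr
      _ = 1 := mul_inv_cancel₀ hr.ne'
  set u := Units.oneSub _ hn with hu
  refine ⟨R * (↑u⁻¹ : H →L[ℂ] H), fun y => ?_⟩
  set z := (↑u⁻¹ : H →L[ℂ] H) y with hz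
  have h1 : z - ((r : ℂ) - s) • R z = y := by
    have : (u * (↑u⁻¹) : H →L[ℂ] H) y = y := by rw [Units.mul_inv]; rfl
    exact this
  refine ⟨hR.mem z, ?_⟩
  show (s : ℂ) • R z - A ⟨R z, hR.mem z⟩ = y
  rw [hR.apply_eq, ← h1, sub_smul]
  abel

end IsResolventAt

theorem IsMaxDissipative.exists_resolvent_one (hA : IsMaxDissipative A) :
    ∃ R : H →L[ℂ] H, IsResolventAt A 1 R := by
  choose f hf using hA.exists_sub_eq
  have hinj : ∀ {x y : A.domain}, (x : H) - A x = (y : H) - A y → x = y := fun {x y} h =>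
    hA.eq_of_sub_eq one_pos (by simpa using h)
  let R : H →ₗ[ℂ] H :=
    { toFun := fun y => f y
      map_add' := fun y z => by
        rw [← Submodule.coe_add]
        refine congrArg Subtype.val (hinj ?_)
        rw [hf, LinearPMap.map_add, Submodule.coe_add, add_sub_add_comm, hf, hf]
      map_smul' := fun c y => by
        rw [RingHom.id_apply, ← Submodule.coe_smul]
        refine congrArg Subtype.val (hinj ?_)
        rw [hf, LinearPMap.map_smul, Submodule.coe_smul, ← smul_sub, hf] }
  refine ⟨R.mkContinuous 1 fun y => ?_, fun y => ⟨(f y).2, ?_⟩⟩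
  · have := hA.mul_norm_le 1 (f y)
    rw [Complex.ofReal_one, one_smul, hf] at this
    rw [one_mul]
    linarith [this, show ‖R y‖ = ‖(f y : H)‖ from rfl]
  · show ((1 : ℝ) : ℂ) • (f y : H) - A (f y) = y
    rw [Complex.ofReal_one, one_smul]
    exact hf y

theorem IsMaxDissipative.exists_resolvent [CompleteSpace H] (hA : IsMaxDissipative A) {r : ℝ}
    (hr : 0 < r) : ∃ R : H →L[ℂ] H, IsResolventAt A r R := by
  have h : ∀ n : ℕ, ∃ R : H →L[ℂ] H, IsResolventAt A ((3 / 2) ^ n) R := by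
    intro n
    induction n with
    | zero => simpa using hA.exists_resolvent_one
    | succ n ih =>
      obtain ⟨R, hR⟩ := ih
      refine hR.exists_of_lt hA (by positivity) (by positivity) ?_
      rw [pow_succ]
      have : (0 : ℝ) < (3 / 2) ^ n := by positivity
      linarith
  obtain ⟨n, hn⟩ := pow_unbounded_of_one_lt r (by norm_num : (1 : ℝ) < 3 / 2)
  obtain ⟨R, hR⟩ := h n
  exact hR.exists_of_lt hA (by positivity) hr (by linarith)

/-- The domain of a maximal dissipative operator is dense. -/
theorem IsMaxDissipative.dense_domain [CompleteSpace H] (hA : IsMaxDissipative A) :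
    Dense (A.domain : Set H) := by
  rw [Submodule.dense_iff_topologicalClosure_eq_top, Submodule.topologicalClosure_eq_top_iff,
    Submodule.eq_bot_iff]
  intro v hv
  obtain ⟨x, hx⟩ := hA.exists_sub_eq v
  have h1 : inner ℂ (x : H) v = 0 := (Submodule.mem_orthogonal _ _).1 hv x x.2
  have h2 : (inner ℂ (x : H) ((x : H) - A x)).re = 0 := by rw [hx, h1]; rfl
  have e : (inner ℂ (x : H) (x : H)).re = ‖(x : H)‖ ^ 2 := inner_self_eq_norm_sq (𝕜 := ℂ) _
  rw [inner_sub_right, Complex.sub_re, e] at h2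
  have h3 := hA.re_inner_nonpos x
  have h4 : ‖(x : H)‖ = 0 := by
    have := sq_nonneg ‖(x : H)‖
    exact pow_eq_zero_iff two_ne_zero |>.1 (by linarith)
  have h5 : x = 0 := Subtype.ext (norm_eq_zero.1 h4)
  rw [← hx, h5, LinearPMap.map_zero]
  simp

end Generation

section Yosida

variable {H : Type*} [NormedAddCommGroup H] [InnerProductSpace ℂ H]

/-- The Yosida approximation `r (r R - 1)`, where `R` is the resolvent at `r`. -/
def yosida (r : ℝ) (R : H →L[ℂ] H) : H →L[ℂ] H := (r : ℂ) • ((r : ℂ) • R - 1)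

theorem yosida_apply (r : ℝ) (R : H →L[ℂ] H) (x : H) :
    yosida r R x = (r : ℂ) • ((r : ℂ) • R x - x) := rfl

theorem commute_yosida {r s : ℝ} {R Q : H →L[ℂ] H} (h : Commute R Q) :
    Commute (yosida r R) (yosida s Q) := by
  unfold yosida
  refine Commute.smul_left (Commute.smul_right ?_ _) _
  exact ((((h.smul_left _).smul_right _).sub_right (Commute.one_right _))).sub_left
    (Commute.one_left _)

variable {A : H →ₗ.[ℂ] H} {r : ℝ} {R : H →L[ℂ] H}

theorem IsResolventAt.re_inner_yosida_nonpos (hR : IsResolventAt A r R)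
    (hA : IsMaxDissipative A) (hr : 0 < r) (x : H) : (inner ℂ x (yosida r R x)).re ≤ 0 := by
  set z : A.domain := ⟨R x, hR.mem x⟩ with hz
  have h1 : x = (r : ℂ) • (z : H) - A z := by
    rw [hz, hR.apply_eq]
    abel
  have h2 : yosida r R x = (r : ℂ) • A z := by rw [yosida_apply, hz, hR.apply_eq]
  have e : (inner ℂ (A z) (A z)).re = ‖A z‖ ^ 2 := inner_self_eq_norm_sq (𝕜 := ℂ) _
  rw [h2, re_inner_ofReal_smul]
  refine mul_nonpos_of_nonneg_of_nonpos hr.le ?_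
  rw [h1, inner_sub_left, Complex.sub_re, e, inner_smul_left, Complex.conj_ofReal,
    Complex.re_ofReal_mul]
  have := mul_nonpos_of_nonneg_of_nonpos hr.le (hA.re_inner_nonpos z)
  linarith [sq_nonneg ‖A z‖]

theorem IsResolventAt.yosida_eq (hR : IsResolventAt A r R) (hA : IsMaxDissipative A)
    (hr : 0 < r) (x : A.domain) : yosida r R x = (r : ℂ) • R (A x) := by
  have h1 := hR.apply_sub hA hr x
  rw [map_sub, map_smul] at h1
  rw [yosida_apply]
  congr 1
  linear_combination (norm := module) h1

theorem hasDerivAt_exp_smul_apply {B : H →L[ℂ] H} [CompleteSpace H] (x : H) (t : ℝ) :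
    HasDerivAt (fun s : ℝ => NormedSpace.exp (s • B) x) (NormedSpace.exp (t • B) (B x)) t := by
  have h1 := hasDerivAt_exp_smul_const (𝕂 := ℝ) B t
  exact ((ContinuousLinearMap.apply ℂ H x).restrictScalars ℝ).hasFDerivAt.comp_hasDerivAt t h1

theorem commute_exp_apply [CompleteSpace H] (B : H →L[ℂ] H) (t : ℝ) (x : H) :
    NormedSpace.exp (t • B) (B x) = B (NormedSpace.exp (t • B) x) := by
  let +nondep : NormedAlgebra ℚ (H →L[ℂ] H) := NormedAlgebra.restrictScalars ℚ ℂ _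
  have h : Commute (NormedSpace.exp (t • B)) B :=
    ((Commute.refl B).smul_left t).exp_left
  exact congrArg (fun T : H →L[ℂ] H => T x) h.eq

theorem norm_exp_smul_apply_le [CompleteSpace H] {B : H →L[ℂ] H}
    (hB : ∀ x, (inner ℂ x (B x)).re ≤ 0) {t : ℝ} (ht : 0 ≤ t) (x : H) :
    ‖NormedSpace.exp (t • B) x‖ ≤ ‖x‖ := by
  have := norm_le_of_re_inner_deriv_nonpos (y := fun s : ℝ => NormedSpace.exp (s • B) x)
    (fun s _ => (hasDerivAt_exp_smul_apply x s).hasDerivWithinAt)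
    (fun s _ => by
      rw [commute_exp_apply]
      exact hB _) ht
  simpa using this

theorem norm_exp_sub_exp_le [CompleteSpace H] {B C : H →L[ℂ] H} (hBC : Commute B C)
    (hB : ∀ x, (inner ℂ x (B x)).re ≤ 0) (hC : ∀ x, (inner ℂ x (C x)).re ≤ 0) {t : ℝ}
    (ht : 0 ≤ t) (x : H) :
    ‖NormedSpace.exp (t • B) x - NormedSpace.exp (t • C) x‖ ≤ t * ‖B x - C x‖ := by
  let +nondep : NormedAlgebra ℚ (H →L[ℂ] H) := NormedAlgebra.restrictScalars ℚ ℂ _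
  have hmul : ∀ s : ℝ, NormedSpace.exp (t • C) * NormedSpace.exp (s • (B - C)) =
      NormedSpace.exp (s • B) * NormedSpace.exp ((t - s) • C) := by
    intro s
    have c1 : Commute (t • C) (s • (B - C)) :=
      ((hBC.symm.sub_right (Commute.refl C)).smul_left t).smul_right s
    have c2 : Commute (s • B) ((t - s) • C) := (hBC.smul_left s).smul_right _
    rw [← NormedSpace.exp_add_of_commute c1, ← NormedSpace.exp_add_of_commute c2]
    congr 1
    module
  have hd : ∀ s ∈ Icc 0 t, HasDerivWithinAt
      (fun s : ℝ => NormedSpace.exp (t • C) (NormedSpace.exp (s • (B - C)) x))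
      (NormedSpace.exp (t • C) (NormedSpace.exp (s • (B - C)) ((B - C) x))) (Icc 0 t) s :=
    fun s _ => ((((NormedSpace.exp (t • C) : H →L[ℂ] H).restrictScalars ℝ).hasFDerivAt
      ).comp_hasDerivAt s (hasDerivAt_exp_smul_apply x s)).hasDerivWithinAt
  have hb : ∀ s ∈ Ico 0 t,
      ‖NormedSpace.exp (t • C) (NormedSpace.exp (s • (B - C)) ((B - C) x))‖ ≤ ‖B x - C x‖ := by
    intro s hs
    have := congrArg (fun T : H →L[ℂ] H => T ((B - C) x)) (hmul s)
    simp only [mul_apply_eq_comp] at this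
    rw [this]
    exact (norm_exp_smul_apply_le hB hs.1 _).trans
      (norm_exp_smul_apply_le hC (sub_nonneg.2 hs.2.le) _)
  have key := norm_image_sub_le_of_norm_deriv_le_segment' hd hb t (right_mem_Icc.2 ht)
  have e := congrArg (fun T : H →L[ℂ] H => T x) (hmul t)
  simp only [mul_apply_eq_comp, sub_self, zero_smul, NormedSpace.exp_zero,
    one_apply_eq_self] at e
  simp only [zero_smul, NormedSpace.exp_zero, one_apply_eq_self, e] at key
  linarith

end Yosida

section Semigroup

variable {H : Type*} [NormedAddCommGroup H] [InnerProductSpace ℂ H] {A : H →ₗ.[ℂ] H}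

theorem tendsto_self_of_dense {ι : Type*} {l : Filter ι} {T : ι → H →L[ℂ] H}
    (hT : ∀ i x, ‖T i x‖ ≤ ‖x‖) {D : Set H} (hD : Dense D)
    (h : ∀ x ∈ D, Tendsto (fun i => T i x) l (𝓝 x)) (x : H) :
    Tendsto (fun i => T i x) l (𝓝 x) := by
  rw [Metric.tendsto_nhds]
  intro ε hε
  obtain ⟨y, hyD, hy⟩ := hD.exists_dist_lt x (by positivity : 0 < ε / 3)
  filter_upwards [Metric.tendsto_nhds.1 (h y hyD) (ε / 3) (by positivity)] with i hi
  have h1 : dist (T i x) (T i y) ≤ dist x y := by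
    rw [dist_eq_norm, dist_eq_norm, ← map_sub]
    exact hT i _
  have h2 := dist_triangle4_right (T i x) x (T i y) y
  linarith

theorem cauchySeq_of_dense {T : ℕ → H →L[ℂ] H} (hT : ∀ i x, ‖T i x‖ ≤ ‖x‖) {D : Set H}
    (hD : Dense D) (h : ∀ x ∈ D, CauchySeq fun i => T i x) (x : H) :
    CauchySeq fun i => T i x := by
  rw [Metric.cauchySeq_iff]
  intro ε hε
  obtain ⟨y, hyD, hy⟩ := hD.exists_dist_lt x (by positivity : 0 < ε / 3)
  obtain ⟨N, hN⟩ := Metric.cauchySeq_iff.1 (h y hyD) (ε / 3) (by positivity)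
  refine ⟨N, fun m hm n hn => ?_⟩
  have h1 : ∀ i, dist (T i x) (T i y) ≤ dist x y := fun i => by
    rw [dist_eq_norm, dist_eq_norm, ← map_sub]
    exact hT i _
  have h2 := dist_triangle4_right (T m x) (T n x) (T m y) (T n y)
  linarith [h1 m, h1 n, hN m hm n hn]

theorem tendsto_resolvent_smul [CompleteSpace H] (hA : IsMaxDissipative A) {r : ℕ → ℝ}
    (hr : ∀ n, 0 < r n) (hr' : Tendsto r atTop atTop) {R : ℕ → H →L[ℂ] H}
    (hR : ∀ n, IsResolventAt A (r n) (R n)) (x : H) :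
    Tendsto (fun n => (r n : ℂ) • R n x) atTop (𝓝 x) := by
  refine tendsto_self_of_dense (T := fun n => (r n : ℂ) • R n) (fun n y => ?_) hA.dense_domain
    (fun y hy => ?_) x
  · rw [smul_apply, norm_smul, Complex.norm_real, Real.norm_of_nonneg (hr n).le]
    exact (hR n).norm_apply_le hA y
  · rw [tendsto_iff_norm_sub_tendsto_zero]
    refine squeeze_zero (g := fun n => (r n)⁻¹ * ‖A ⟨y, hy⟩‖) (fun n => norm_nonneg _)
      (fun n => ?_) ?_
    · have h1 := (hR n).apply_sub hA (hr n) ⟨y, hy⟩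
      rw [map_sub, map_smul] at h1
      have h2 : ((r n : ℂ) • R n) y - y = R n (A ⟨y, hy⟩) := by
        rw [smul_apply]
        linear_combination (norm := module) h1
      rw [h2]
      refine ((R n).le_opNorm _).trans ?_
      gcongr
      exact (hR n).norm_le hA (hr n)
    · simpa using (tendsto_inv_atTop_zero.comp hr').mul_const ‖A ⟨y, hy⟩‖

theorem tendsto_yosida [CompleteSpace H] (hA : IsMaxDissipative A) {r : ℕ → ℝ}
    (hr : ∀ n, 0 < r n) (hr' : Tendsto r atTop atTop) {R : ℕ → H →L[ℂ] H}
    (hR : ∀ n, IsResolventAt A (r n) (R n)) (x : A.domain) :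
    Tendsto (fun n => yosida (r n) (R n) x) atTop (𝓝 (A x)) := by
  simp_rw [fun n => (hR n).yosida_eq hA (hr n) x]
  exact tendsto_resolvent_smul hA hr hr' hR _

theorem tendsto_coe_nnreal_nhdsGT :
    Tendsto (fun t : ℝ≥0 => (t : ℝ)) (𝓝[>] 0) (𝓝[>] 0) := by
  refine tendsto_nhdsWithin_iff.2 ⟨?_, ?_⟩
  · exact (NNReal.continuous_coe.tendsto' 0 0 rfl).mono_left nhdsWithin_le_nhds
  · filter_upwards [self_mem_nhdsWithin] with t ht
    exact NNReal.coe_pos.2 ht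

/-- A semigroup of contractions whose orbits starting in the domain of a maximal dissipative
operator `A` have derivative `A x` at `0` is generated by `A`. -/
theorem isGenerator_of_tendsto (hA : IsMaxDissipative A) {S : ℝ≥0 → H →L[ℂ] H}
    (hS : ∀ t x, ‖S t x‖ ≤ ‖x‖)
    (h : ∀ x : A.domain, Tendsto (fun t : ℝ≥0 => ((t : ℝ) : ℂ)⁻¹ • (S t x - x)) (𝓝[>] 0)
      (𝓝 (A x))) : IsGenerator A S := by
  intro x y
  constructor
  · rintro ⟨hx, rfl⟩
    exact h ⟨x, hx⟩
  · intro hy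
    obtain ⟨z, hz⟩ := hA.exists_sub_eq (x - y)
    have h1 : Tendsto (fun t : ℝ≥0 => ((t : ℝ) : ℂ)⁻¹ • (S t (x - z) - (x - z))) (𝓝[>] 0)
        (𝓝 (x - z)) := by
      have e : x - (z : H) = y - A z := by linear_combination (norm := module) (-1 : ℂ) • hz
      have e' : Tendsto (fun t : ℝ≥0 => ((t : ℝ) : ℂ)⁻¹ • (S t x - x)
          - ((t : ℝ) : ℂ)⁻¹ • (S t z - z)) (𝓝[>] 0) (𝓝 (x - z)) := by
        rw [e]
        exact hy.sub (h z)
      refine e'.congr fun t => ?_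
      rw [map_sub]
      module
    have h2 : (inner ℂ (x - z) (x - z : H)).re ≤ 0 := by
      refine le_of_tendsto (Complex.continuous_re.tendsto _ |>.comp
        (tendsto_const_nhds.inner h1 : Tendsto _ _ (𝓝 (inner ℂ (x - z) (x - z : H))))) ?_
      refine Eventually.of_forall fun t => ?_
      have e : (inner ℂ (x - z) (x - z : H)).re = ‖x - z‖ ^ 2 := inner_self_eq_norm_sq (𝕜 := ℂ) _
      have e2 : (inner ℂ (x - z) (S t (x - z))).re ≤ ‖x - z‖ * ‖S t (x - z)‖ :=
        re_inner_le_norm (𝕜 := ℂ) _ _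
      have e3 := mul_le_mul_of_nonneg_left (hS t (x - z)) (norm_nonneg (x - z : H))
      simp only [Function.comp_apply]
      rw [← Complex.ofReal_inv, re_inner_ofReal_smul, inner_sub_right, Complex.sub_re, e]
      refine mul_nonpos_of_nonneg_of_nonpos (by positivity) ?_
      nlinarith
    have h3 : x - z = 0 := by
      have e : (inner ℂ (x - z) (x - z : H)).re = ‖x - z‖ ^ 2 := inner_self_eq_norm_sq (𝕜 := ℂ) _
      rw [e] at h2
      have := sq_nonneg ‖x - z‖
      exact norm_eq_zero.1 (pow_eq_zero_iff two_ne_zero |>.1 (le_antisymm h2 this))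
    have h4 : x = z := sub_eq_zero.1 h3
    subst h4
    refine ⟨z.2, ?_⟩
    show A z = y
    exact sub_right_injective hz

/-- **Lumer–Phillips theorem**: a maximal dissipative operator on a Hilbert space generates a
`C₀`-semigroup of contractions. -/
theorem IsMaxDissipative.exists_semigroup [CompleteSpace H] (hA : IsMaxDissipative A) :
    ∃ S : ℝ≥0 → H →L[ℂ] H, IsContractionSemigroup S ∧ IsGenerator A S := by
  let +nondep : NormedAlgebra ℚ (H →L[ℂ] H) := NormedAlgebra.restrictScalars ℚ ℂ _
  set r : ℕ → ℝ := fun n => n + 1 with hrd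
  have hr : ∀ n, 0 < r n := fun n => by positivity
  have hr' : Tendsto r atTop atTop :=
    tendsto_atTop_add_const_right _ _ tendsto_natCast_atTop_atTop
  choose R hR using fun n => hA.exists_resolvent (hr n)
  set B : ℕ → H →L[ℂ] H := fun n => yosida (r n) (R n) with hBd
  have hB : ∀ n x, (inner ℂ x (B n x)).re ≤ 0 := fun n x =>
    (hR n).re_inner_yosida_nonpos hA (hr n) x
  have hcomm : ∀ m n, Commute (B m) (B n) := fun m n =>
    commute_yosida ((hR m).commute (hR n) hA (hr m) (hr n))
  have hlim : ∀ x : A.domain, Tendsto (fun n => B n x) atTop (𝓝 (A x)) :=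
    tendsto_yosida hA hr hr' hR
  have hE : ∀ (t : ℝ≥0) n x, ‖NormedSpace.exp ((t : ℝ) • B n) x‖ ≤ ‖x‖ := fun t n x =>
    norm_exp_smul_apply_le (hB n) t.2 x
  have hcauchy : ∀ (t : ℝ≥0) x, CauchySeq fun n => NormedSpace.exp ((t : ℝ) • B n) x := by
    intro t
    refine cauchySeq_of_dense (hE t) hA.dense_domain fun x hx => ?_
    rw [Metric.cauchySeq_iff]
    intro ε hε
    obtain ⟨N, hN⟩ := Metric.cauchySeq_iff.1 (hlim ⟨x, hx⟩).cauchySeq (ε / (t + 1))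
      (by positivity)
    refine ⟨N, fun m hm n hn => ?_⟩
    have h1 := hN m hm n hn
    rw [dist_eq_norm, lt_div_iff₀ (by positivity)] at h1
    rw [dist_eq_norm]
    have h2 := norm_exp_sub_exp_le (hcomm m n) (hB m) (hB n) t.2 x
    have h3 := norm_nonneg (B m x - B n x)
    simp only [NNReal.val_eq_coe] at h2
    nlinarith
  have hex : ∀ t : ℝ≥0, ∃ T : H →L[ℂ] H, ∀ x,
      Tendsto (fun n => NormedSpace.exp ((t : ℝ) • B n) x) atTop (𝓝 (T x)) := by
    intro t
    choose f hf using fun x => cauchySeq_tendsto_of_complete (hcauchy t x)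
    exact ⟨continuousLinearMapOfTendsto (fun n => NormedSpace.exp ((t : ℝ) • B n))
      (tendsto_pi_nhds.2 hf), hf⟩
  choose S hS using hex
  have hcontr : ∀ t x, ‖S t x‖ ≤ ‖x‖ := fun t x =>
    le_of_tendsto (hS t x).norm (Eventually.of_forall fun n => hE t n x)
  have hSE : ∀ (t : ℝ≥0) n (x : A.domain),
      ‖NormedSpace.exp ((t : ℝ) • B n) x - S t x‖ ≤ t * ‖B n x - A x‖ := fun t n x =>
    le_of_tendsto_of_tendsto (tendsto_const_nhds.sub (hS t x)).norm
      ((tendsto_const_nhds.sub (hlim x)).norm.const_mul _)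
      (Eventually.of_forall fun m => norm_exp_sub_exp_le (hcomm n m) (hB n) (hB m) t.2 x)
  have hS1 : ∀ (t : ℝ≥0) (x : A.domain), ‖S t x - x‖ ≤ t * ‖A x‖ := fun t x =>
    le_of_tendsto_of_tendsto ((hS t x).sub tendsto_const_nhds).norm ((hlim x).norm.const_mul _)
      (Eventually.of_forall fun m => by
        simpa using norm_exp_sub_exp_le (C := 0) (Commute.zero_right _) (hB m) (by simp) t.2 x)
  refine ⟨S, ⟨?_, ?_, ?_, hcontr⟩, isGenerator_of_tendsto hA hcontr fun x => ?_⟩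
  · ext x
    refine tendsto_nhds_unique (hS 0 x) ?_
    simp
  · intro s t
    ext x
    refine tendsto_nhds_unique (hS (s + t) x) ?_
    have e : ∀ n, NormedSpace.exp (((s + t : ℝ≥0) : ℝ) • B n) x
        = NormedSpace.exp ((s : ℝ) • B n) (NormedSpace.exp ((t : ℝ) • B n) x) := by
      intro n
      rw [NNReal.coe_add, add_smul, NormedSpace.exp_add_of_commute
        (((Commute.refl (B n)).smul_left _).smul_right _)]
      rfl
    simp_rw [e]
    rw [tendsto_iff_norm_sub_tendsto_zero]
    refine squeeze_zero (g := fun n => ‖NormedSpace.exp ((t : ℝ) • B n) x - S t x‖ +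
      ‖NormedSpace.exp ((s : ℝ) • B n) (S t x) - S s (S t x)‖) (fun n => norm_nonneg _)
      (fun n => ?_) ?_
    · have h1 := hE s n (NormedSpace.exp ((t : ℝ) • B n) x - S t x)
      rw [map_sub] at h1
      refine (norm_sub_le_norm_sub_add_norm_sub _ (NormedSpace.exp ((s : ℝ) • B n) (S t x))
        _).trans ?_
      gcongr
      exact le_rfl
    · simpa using (tendsto_iff_norm_sub_tendsto_zero.1 (hS t x)).add
        (tendsto_iff_norm_sub_tendsto_zero.1 (hS s (S t x)))
  · refine tendsto_self_of_dense hcontr hA.dense_domain fun x hx => ?_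
    rw [tendsto_iff_norm_sub_tendsto_zero]
    refine squeeze_zero (g := fun t : ℝ≥0 => (t : ℝ) * ‖A ⟨x, hx⟩‖) (fun t => norm_nonneg _)
      (fun t => hS1 t ⟨x, hx⟩) ?_
    have : Continuous fun t : ℝ≥0 => (t : ℝ) * ‖A ⟨x, hx⟩‖ := by fun_prop
    exact this.tendsto' 0 0 (by simp)
  · rw [Metric.tendsto_nhds]
    intro ε hε
    obtain ⟨n, hn⟩ := (Metric.tendsto_nhds.1 (hlim x) (ε / 3) (by positivity)).exists
    have hd := (hasDerivAt_exp_smul_apply (B := B n) (x : H) 0).tendsto_slope_zero_right.comp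
      tendsto_coe_nnreal_nhdsGT
    filter_upwards [Metric.tendsto_nhds.1 hd (ε / 3) (by positivity), self_mem_nhdsWithin]
      with t ht ht0
    have ht0' : (0 : ℝ) < t := ht0
    simp only [Function.comp_apply, zero_add, zero_smul, NormedSpace.exp_zero,
      one_apply_eq_self] at ht
    rw [dist_eq_norm] at ht hn ⊢
    set e := NormedSpace.exp ((t : ℝ) • B n) (x : H) with he
    have h1 : ((t : ℝ) : ℂ)⁻¹ • (S t x - x) - A x =
        -(((t : ℝ) : ℂ)⁻¹ • (e - S t x)) + ((t : ℝ)⁻¹ • (e - x) - B n x) + (B n x - A x) := by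
      have : (t : ℝ)⁻¹ • (e - x) = ((t : ℝ) : ℂ)⁻¹ • (e - x) := by
        rw [← Complex.ofReal_inv, Complex.coe_smul]
      rw [this]
      module
    have h2 : ‖-(((t : ℝ) : ℂ)⁻¹ • (e - S t x))‖ ≤ ‖B n x - A x‖ := by
      rw [norm_neg, norm_smul, norm_inv, Complex.norm_real, Real.norm_of_nonneg ht0'.le,
        inv_mul_le_iff₀ ht0']
      exact hSE t n x
    rw [h1]
    have h3 := norm_add₃_le (a := -(((t : ℝ) : ℂ)⁻¹ • (e - S t x)))
      (b := (t : ℝ)⁻¹ • (e - x) - B n x) (c := B n x - A x)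
    linarith

end Semigroup

section Cauchy

variable {H : Type*} [NormedAddCommGroup H] [InnerProductSpace ℂ H] {A : H →ₗ.[ℂ] H}
  {S : ℝ≥0 → H →L[ℂ] H}

theorem IsContractionSemigroup.map_add_apply (hS : IsContractionSemigroup S) (s t : ℝ≥0) (x : H) :
    S (s + t) x = S s (S t x) := by rw [hS.map_add]; rfl

theorem IsContractionSemigroup.norm_sub_le (hS : IsContractionSemigroup S) {s t : ℝ≥0}
    (h : s ≤ t) (x : H) : ‖S t x - S s x‖ ≤ ‖S (t - s) x - x‖ := by
  have : S t x = S s (S (t - s) x) := by rw [← hS.map_add_apply, add_tsub_cancel_of_le h]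
  rw [this, ← map_sub]
  exact hS.contraction _ _

theorem IsContractionSemigroup.continuous (hS : IsContractionSemigroup S) (x : H) :
    Continuous fun t => S t x := by
  have h0 : Tendsto (fun t => ‖S t x - x‖) (𝓝 0) (𝓝 0) :=
    tendsto_iff_norm_sub_tendsto_zero.1 (hS.strongly_continuous x)
  rw [continuous_iff_continuousAt]
  intro t
  rw [ContinuousAt, tendsto_iff_norm_sub_tendsto_zero]
  have h1 : ∀ s, ‖S s x - S t x‖ ≤ ‖S (s - t) x - x‖ + ‖S (t - s) x - x‖ := by
    intro s
    rcases le_total s t with h | h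
    · rw [norm_sub_rev]
      exact (hS.norm_sub_le h x).trans (le_add_of_nonneg_left (norm_nonneg _))
    · exact (hS.norm_sub_le h x).trans (le_add_of_nonneg_right (norm_nonneg _))
  refine squeeze_zero (fun _ => norm_nonneg _) h1 ?_
  have c1 : Tendsto (fun s : ℝ≥0 => s - t) (𝓝 t) (𝓝 0) :=
    (continuous_id.sub continuous_const).tendsto' t 0 (by simp)
  have c2 : Tendsto (fun s : ℝ≥0 => t - s) (𝓝 t) (𝓝 0) :=
    (continuous_const.sub continuous_id).tendsto' t 0 (by simp)
  simpa using (h0.comp c1).add (h0.comp c2)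

theorem IsContractionSemigroup.continuous_toNNReal (hS : IsContractionSemigroup S) (x : H) :
    Continuous fun t : ℝ => S t.toNNReal x := (hS.continuous x).comp continuous_real_toNNReal

theorem IsGenerator.exists_apply_eq (hG : IsGenerator A S) (hS : IsContractionSemigroup S)
    (x : A.domain) (t : ℝ≥0) :
    ∃ h : S t x ∈ A.domain, A ⟨S t x, h⟩ = S t (A x) := by
  refine (hG _ _).2 ?_
  have h1 := ((S t).continuous.tendsto _).comp ((hG x (A x)).1 ⟨x.2, rfl⟩)
  refine h1.congr fun s => ?_
  simp only [Function.comp_apply, map_smul, map_sub]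
  rw [← hS.map_add_apply, ← hS.map_add_apply, add_comm]

theorem IsGenerator.hasDerivWithinAt_Ioi (hG : IsGenerator A S) (hS : IsContractionSemigroup S)
    (x : A.domain) {t : ℝ} (ht : 0 ≤ t) :
    HasDerivWithinAt (fun t : ℝ => S t.toNNReal x) (S t.toNNReal (A x)) (Ioi t) t := by
  rw [hasDerivWithinAt_iff_tendsto_slope' self_notMem_Ioi]
  have h1 := ((S t.toNNReal).continuous.tendsto _).comp ((hG x (A x)).1 ⟨x.2, rfl⟩)
  have h2 : Tendsto (fun s : ℝ => (s - t).toNNReal) (𝓝[>] t) (𝓝[>] 0) := by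
    refine tendsto_nhdsWithin_iff.2 ⟨?_, ?_⟩
    · have : Continuous fun s : ℝ => (s - t).toNNReal :=
        continuous_real_toNNReal.comp (continuous_id.sub continuous_const)
      exact (this.tendsto' t 0 (by simp)).mono_left nhdsWithin_le_nhds
    · filter_upwards [self_mem_nhdsWithin] with s hs
      exact Real.toNNReal_pos.2 (sub_pos.2 hs)
  refine (h1.comp h2).congr' ?_
  filter_upwards [self_mem_nhdsWithin] with s hs
  have hs' : t < s := hs
  have e : s.toNNReal = t.toNNReal + (s - t).toNNReal := by
    rw [← Real.toNNReal_add ht (by linarith)]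
    congr 1
    ring
  simp only [Function.comp_apply, slope_def_module, map_smul, map_sub]
  rw [e, hS.map_add_apply, Real.coe_toNNReal _ (by linarith), ← Complex.ofReal_inv,
    Complex.coe_smul]

theorem IsGenerator.hasDerivWithinAt [CompleteSpace H] (hG : IsGenerator A S)
    (hS : IsContractionSemigroup S) (x : A.domain) {t : ℝ} (ht : 0 ≤ t) :
    HasDerivWithinAt (fun t : ℝ => S t.toNNReal x) (S t.toNNReal (A x)) (Ici 0) t := by
  have hc := hS.continuous_toNNReal (A x)
  have h1 : ∀ s, 0 ≤ s → S s.toNNReal x = (∫ u in (0 : ℝ)..s, S u.toNNReal (A x)) + x := by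
    intro s hs
    rw [intervalIntegral.integral_eq_sub_of_hasDeriv_right_of_le hs
      (hS.continuous_toNNReal x).continuousOn
      (fun u hu => hG.hasDerivWithinAt_Ioi hS x hu.1.le) (hc.intervalIntegrable _ _)]
    simp [hS.map_zero]
  exact ((hc.integral_hasStrictDerivAt 0 t).hasDerivAt.add_const (x : H)).hasDerivWithinAt.congr
    h1 (h1 t ht)

theorem IsGenerator.isStrongSolution [CompleteSpace H] (hG : IsGenerator A S)
    (hS : IsContractionSemigroup S) {x : H} (hx : x ∈ A.domain) :
    IsStrongSolution A x fun t : ℝ => S t.toNNReal x := by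
  have hm := fun t : ℝ => hG.exists_apply_eq hS ⟨x, hx⟩ t.toNNReal
  have hd := fun (t : ℝ) (ht : 0 ≤ t) => hG.hasDerivWithinAt hS ⟨x, hx⟩ ht
  refine ⟨fun t _ => (hm t).1, ?_, ?_, ?_, fun t ht => ?_⟩
  · have : Continuous fun t : Ici (0 : ℝ) =>
        (S (t : ℝ).toNNReal x, S (t : ℝ).toNNReal (A ⟨x, hx⟩)) :=
      ((hS.continuous_toNNReal x).comp continuous_subtype_val).prodMk
        ((hS.continuous_toNNReal (A ⟨x, hx⟩)).comp continuous_subtype_val)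
    refine this.congr fun t => ?_
    rw [← (hm t).2]
  · rw [contDiffOn_one_iff_derivWithin (uniqueDiffOn_Ici 0)]
    refine ⟨fun t ht => (hd t ht).differentiableWithinAt, ?_⟩
    exact (hS.continuous_toNNReal (A ⟨x, hx⟩)).continuousOn.congr fun t ht =>
      (hd t ht).derivWithin (uniqueDiffOn_Ici 0 t ht)
  · simp [hS.map_zero]
  · rw [(hm t).2]
    exact hd t ht

theorem IsMaxDissipative.strongSolution_unique (hA : IsMaxDissipative A) {x : H} {U V : ℝ → H}
    (hU : IsStrongSolution A x U) (hV : IsStrongSolution A x V) : EqOn U V (Ici 0) := by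
  intro t ht
  have hd := fun s hs => (hU.strong_eq s hs).sub (hV.strong_eq s hs)
  have := norm_le_of_re_inner_deriv_nonpos (y := U - V) (y' := derivWithin (U - V) (Ici 0))
    (fun s hs => (hd s hs).differentiableWithinAt.hasDerivWithinAt) (fun s hs => ?_) ht
  · simp only [Pi.sub_apply, hU.initial, hV.initial, sub_self, norm_zero] at this
    exact sub_eq_zero.1 (norm_le_zero_iff.1 this)
  · rw [(hd s hs).derivWithin (uniqueDiffOn_Ici 0 s hs), ← LinearPMap.map_sub]
    exact hA.re_inner_nonpos (⟨U s, hU.mem_domain s hs⟩ - ⟨V s, hV.mem_domain s hs⟩)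

theorem absolutelyContinuousOnInterval_of_hasDerivWithinAt {f f' : ℝ → ℂ} {T : ℝ} (hT : 0 < T)
    (hf : ∀ t, 0 ≤ t → HasDerivWithinAt f (f' t) (Ici 0) t) (hf' : Continuous f') :
    AbsolutelyContinuousOnInterval f 0 T := by
  refine ContDiffOn.absolutelyContinuousOnInterval ?_
  rw [uIcc_of_le hT.le]
  refine ContDiffOn.mono (s := Ici 0) ?_ Icc_subset_Ici_self
  rw [contDiffOn_one_iff_derivWithin (uniqueDiffOn_Ici 0)]
  exact ⟨fun t ht => (hf t ht).differentiableWithinAt, hf'.continuousOn.congr fun t ht =>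
      (hf t ht).derivWithin (uniqueDiffOn_Ici 0 t ht)⟩

theorem IsGenerator.hasDerivWithinAt_inner [CompleteSpace H] (hG : IsGenerator A S)
    (hS : IsContractionSemigroup S) (hA : IsMaxDissipative A) {V W : H} (hVW : IsAdjointAt A V W)
    (x : H) {t : ℝ} (ht : 0 ≤ t) :
    HasDerivWithinAt (fun t : ℝ => inner ℂ V (S t.toNNReal x)) (inner ℂ W (S t.toNNReal x))
      (Ici 0) t := by
  obtain ⟨z, hz⟩ := hA.exists_sub_eq x
  have hadj : ∀ t : ℝ, inner ℂ V (S t.toNNReal (A z)) = inner ℂ W (S t.toNNReal z) := by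
    intro t
    obtain ⟨h, e⟩ := hG.exists_apply_eq hS z t.toNNReal
    rw [← e]
    exact hVW ⟨_, h⟩
  have hd : ∀ V' : H, HasDerivWithinAt (fun t : ℝ => inner ℂ V' (S t.toNNReal z))
      (inner ℂ V' (S t.toNNReal (A z))) (Ici 0) t := fun V' =>
    ((innerSL ℂ V').restrictScalars ℝ).hasFDerivAt.comp_hasDerivWithinAt t
      (hG.hasDerivWithinAt hS z ht)
  have h := (hd V).sub (hd W)
  rw [← hz]
  simp only [map_sub, inner_sub_right, hadj]
  rw [hadj] at h
  exact h

theorem IsGenerator.isWeakSolution [CompleteSpace H] (hG : IsGenerator A S)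
    (hS : IsContractionSemigroup S) (hA : IsMaxDissipative A) (x : H) :
    IsWeakSolution A x fun t : ℝ => S t.toNNReal x := by
  refine ⟨(hS.continuous_toNNReal x).continuousOn, by simp [hS.map_zero], ?_, ?_⟩
  · intro V W h T hT
    exact absolutelyContinuousOnInterval_of_hasDerivWithinAt hT
      (fun t ht => hG.hasDerivWithinAt_inner hS hA h x ht)
      (continuous_const.inner (hS.continuous_toNNReal x))
  · intro V W h
    exact Eventually.of_forall fun t ht =>
      (hG.hasDerivWithinAt_inner hS hA h x ht.le).hasDerivAt (Ici_mem_nhds ht)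

theorem IsWeakSolution.sub {x y : H} {U V : ℝ → H} (hU : IsWeakSolution A x U)
    (hV : IsWeakSolution A y V) : IsWeakSolution A (x - y) (U - V) := by
  refine ⟨hU.continuousOn.sub hV.continuousOn, by simp [hU.initial, hV.initial], ?_, ?_⟩
  · intro X Y h T hT
    have := (hU.absolutelyContinuous X Y h T hT).sub (hV.absolutelyContinuous X Y h T hT)
    simp only [Pi.sub_apply, inner_sub_right]
    exact this
  · intro X Y h
    filter_upwards [hU.weak_eq X Y h, hV.weak_eq X Y h] with t h1 h2 ht
    simp only [Pi.sub_apply, inner_sub_right]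
    exact (h1 ht).sub (h2 ht)

/-- An absolutely continuous function is the integral of its derivative, if the latter has a
continuous representative. -/
theorem eq_integral_of_absolutelyContinuous {f g : ℝ → ℂ} {T : ℝ} (hT : 0 < T)
    (hf : AbsolutelyContinuousOnInterval f 0 T) (hg : Continuous g)
    (h : ∀ᵐ t : ℝ, 0 < t → HasDerivAt f (g t) t) (h0 : f 0 = 0) : f T = ∫ s in (0 : ℝ)..T, g s := by
  have hd : ∀ t, HasDerivAt (fun t => ∫ s in (0 : ℝ)..t, g s) (g t) t := fun t =>
    (hg.integral_hasStrictDerivAt 0 t).hasDerivAt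
  have hac := hf.sub (absolutelyContinuousOnInterval_of_hasDerivWithinAt hT (fun t _ => (hd t).hasDerivWithinAt) hg)
  obtain ⟨C, hC⟩ := hac.const_of_ae_hasDerivAt_zero (by
    have h0 : ∀ᵐ t : ℝ, t ≠ 0 := by simp [ae_iff, measure_singleton]
    filter_upwards [h, h0] with t ht ht0 htm
    rw [uIcc_of_le hT.le] at htm
    simpa using (ht (lt_of_le_of_ne htm.1 (Ne.symm ht0))).sub (hd t))
  have h1 := hC 0 left_mem_uIcc
  have h2 := hC T right_mem_uIcc
  simp only [Pi.sub_apply, h0, intervalIntegral.integral_same, sub_self] at h1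
  rw [← h1] at h2
  exact sub_eq_zero.1 h2

theorem IsWeakSolution.eq_zero [CompleteSpace H] (hA : IsMaxDissipative A) {U : ℝ → H}
    (hU : IsWeakSolution A 0 U) {t : ℝ} (ht : 0 ≤ t) : U t = 0 := by
  obtain ⟨R, hR⟩ := hA.exists_resolvent one_pos
  have hRA : ∀ X : A.domain, R (A X) = R X - X := by
    intro X
    have := hR.apply_sub hA one_pos X
    simp only [Complex.ofReal_one, one_smul, map_sub] at this
    linear_combination (norm := module) (-1 : ℂ) • this
  have hadj : ∀ x : H, IsAdjointAt A (R.adjoint x) (R.adjoint x - x) := by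
    intro x X
    rw [ContinuousLinearMap.adjoint_inner_left, inner_sub_left,
      ContinuousLinearMap.adjoint_inner_left, hRA, inner_sub_right]
  set u : ℝ → H := fun s => U (max 0 s) with hu
  have huc : Continuous u := by
    rw [← continuousOn_univ]
    exact hU.continuousOn.comp (continuous_const.max continuous_id).continuousOn
      (fun s _ => mem_Ici.2 (le_max_left _ _))
  have hu' : ∀ s, 0 ≤ s → u s = U s := fun s hs => by rw [hu]; simp [hs]
  set g : ℝ → H := fun s => R (u s) - u s with hg
  have hgc : Continuous g := (R.continuous.comp huc).sub huc
  have key : ∀ s, 0 ≤ s → R (U s) = ∫ τ in (0 : ℝ)..s, g τ := by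
    intro s hs
    rcases hs.eq_or_lt with rfl | hs
    · simp [hU.initial]
    refine ext_inner_left ℂ fun x => ?_
    have h1 := eq_integral_of_absolutelyContinuous hs
      (hU.absolutelyContinuous _ _ (hadj x) s hs)
      (g := fun τ => inner ℂ x (g τ)) (continuous_const.inner hgc) (by
        filter_upwards [hU.weak_eq _ _ (hadj x)] with τ h2 hτ
        refine (h2 hτ).congr_deriv ?_
        simp only [hg]
        rw [hu' τ hτ.le, inner_sub_left, inner_sub_right, ContinuousLinearMap.adjoint_inner_left])
      (by simp [hU.initial])
    rw [ContinuousLinearMap.adjoint_inner_left] at h1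
    rw [h1]
    exact ((innerSL ℂ x).restrictScalars ℝ).intervalIntegral_comp_comm
      (hgc.intervalIntegrable _ _)
  have hd : ∀ s, 0 ≤ s → HasDerivWithinAt (fun s => R (U s)) (g s) (Ici 0) s := fun s hs =>
    (hgc.integral_hasStrictDerivAt 0 s).hasDerivAt.hasDerivWithinAt.congr
      (fun τ hτ => key τ hτ) (key s hs)
  have h0 := norm_le_of_re_inner_deriv_nonpos hd (fun s hs => by
    have h1 := hA.re_inner_nonpos ⟨R (U s), hR.mem _⟩
    rw [hR.apply_eq, Complex.ofReal_one, one_smul] at h1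
    simp only [hg]
    rwa [hu' s hs]) ht
  simp only [hU.initial, map_zero, norm_zero] at h0
  obtain ⟨h, e⟩ := hR (U t)
  have h1 : (⟨R (U t), h⟩ : A.domain) = 0 := Subtype.ext (norm_le_zero_iff.1 h0)
  rw [h1, LinearPMap.map_zero, norm_le_zero_iff.1 h0] at e
  simpa using e.symm

theorem IsMaxDissipative.weakSolution_unique [CompleteSpace H] (hA : IsMaxDissipative A) {x : H}
    {U V : ℝ → H} (hU : IsWeakSolution A x U) (hV : IsWeakSolution A x V) :
    EqOn U V (Ici 0) := by
  intro t ht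
  have h := hU.sub hV
  rw [sub_self] at h
  exact sub_eq_zero.1 (h.eq_zero hA ht)

end Cauchy

/-! ### Integration by parts and Poincaré inequalities -/

theorem mem_closure_testPairs {L : ℝ} {u : L2 L} (hu : u ∈ H10 L) :
    (u, dx u) ∈ (testPairs L).topologicalClosure := by
  obtain ⟨p, hp, rfl⟩ := hu
  have : dx p.1 = p.2 := (isWeakDeriv_of_mem_closure hp).dx_eq
  show (p.1, dx p.1) ∈ _
  rw [this]
  exact hp

theorem mem_H10_of_mem_closure {L : ℝ} {u g : L2 L}
    (h : (u, g) ∈ (testPairs L).topologicalClosure) : u ∈ H10 L ∧ dx u = g :=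
  ⟨⟨_, h, rfl⟩, (isWeakDeriv_of_mem_closure h).dx_eq⟩

theorem dx_sub {L : ℝ} {u v : L2 L} (hu : u ∈ H1 L) (hv : v ∈ H1 L) :
    dx (u - v) = dx u - dx v := by
  rw [sub_eq_add_neg, ← neg_one_smul ℂ v, dx_add hu (Submodule.smul_mem _ _ hv), dx_smul _ hv,
    neg_one_smul, sub_eq_add_neg]

theorem isTest_conj {L : ℝ} {φ : ℝ → ℂ} (h : IsTest L φ) : IsTest L (conj ∘ φ) := by
  have hs : tsupport (conj ∘ φ) ⊆ tsupport φ := by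
    refine closure_mono fun x hx h0 => hx ?_
    simp [h0]
  exact ⟨Complex.conjCLE.contDiff.comp h.smooth,
    h.compact.of_isClosed_subset (isClosed_tsupport _) hs, hs.trans h.supp⟩

theorem IsTest.hasDerivAt {L : ℝ} {φ : ℝ → ℂ} (h : IsTest L φ) (x : ℝ) :
    HasDerivAt φ (deriv φ x) x := (h.smooth.differentiable (by simp) x).hasDerivAt

theorem IsTest.deriv_conj {L : ℝ} {φ : ℝ → ℂ} (h : IsTest L φ) (x : ℝ) :
    deriv (conj ∘ φ) x = conj (deriv φ x) :=
  (Complex.conjCLE.hasFDerivAt.comp_hasDerivAt x (h.hasDerivAt x)).deriv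

theorem IsTest.toLp_mem {L : ℝ} {φ : ℝ → ℂ} (h : IsTest L φ) :
    ((memLp_of_continuous L h.smooth.continuous).toLp φ,
      (memLp_of_continuous L h.deriv_continuous).toLp (deriv φ)) ∈ testPairs L :=
  ⟨φ, h, (memLp_of_continuous L h.smooth.continuous).coeFn_toLp,
    (memLp_of_continuous L h.deriv_continuous).coeFn_toLp⟩

theorem isWeakDeriv_iff_testPairs {L : ℝ} {f g : L2 L} : IsWeakDeriv L f g ↔
    ∀ p ∈ testPairs L, inner ℂ p.2 f + inner ℂ p.1 g = 0 := by
  rw [isWeakDeriv_iff]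
  constructor
  · rintro h p ⟨φ, hφ, h1, h2⟩
    have h3 := h _ (isTest_conj hφ)
    convert h3 using 3
    · refine Lp.ext ?_
      filter_upwards [h2, (memLp_of_continuous L (Complex.continuous_conj.comp
        (isTest_conj hφ).deriv_continuous)).coeFn_toLp] with x hx hx'
      rw [hx, hx', Function.comp_apply, hφ.deriv_conj, Complex.conj_conj]
    · refine Lp.ext ?_
      filter_upwards [h1, (memLp_of_continuous L (Complex.continuous_conj.comp
        (isTest_conj hφ).smooth.continuous)).coeFn_toLp] with x hx hx'
      rw [hx, hx']
      simp
  · intro h φ hφ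
    have h3 := h _ (isTest_conj hφ).toLp_mem
    have e : deriv (conj ∘ φ) = conj ∘ deriv φ := funext hφ.deriv_conj
    simp only [e] at h3
    exact h3

theorem isWeakDeriv_of_forall_H10 {L : ℝ} {f g : L2 L}
    (h : ∀ u ∈ H10 L, inner ℂ (dx u) f + inner ℂ u g = 0) : IsWeakDeriv L f g := by
  rw [isWeakDeriv_iff_testPairs]
  intro p hp
  obtain ⟨h1, h2⟩ := mem_H10_of_mem_closure (Submodule.le_topologicalClosure _ hp)
  rw [← h2]
  exact h _ h1

/-- Integration by parts. -/
theorem inner_dx_left {L : ℝ} {u f : L2 L} (hu : u ∈ H10 L) (hf : f ∈ H1 L) :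
    inner ℂ (dx u) f = -inner ℂ u (dx f) := by
  rw [eq_neg_iff_add_eq_zero]
  refine closure_minimal (s := (testPairs L : Set (L2 L × L2 L))) (t := {p : L2 L × L2 L |
    inner ℂ p.2 f + inner ℂ p.1 (dx f) = 0}) (isWeakDeriv_iff_testPairs.1 (isWeakDeriv_dx hf))
    ?_ (mem_closure_testPairs hu)
  refine isClosed_eq ?_ continuous_const
  exact (continuous_snd.inner continuous_const).add (continuous_fst.inner continuous_const)

/-- A Poincaré inequality for `u_x - i r u` on test functions. -/
theorem norm_le_of_mem_testPairs {L : ℝ} (hL : 0 ≤ L) (r : ℝ) {p : L2 L × L2 L}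
    (hp : p ∈ testPairs L) : ‖p.1‖ ≤ 2 * L * ‖p.2 - (Complex.I * r) • p.1‖ := by
  obtain ⟨φ, hφ, h1, h2⟩ := hp
  have hc := hφ.smooth.continuous
  have hc' := hφ.deriv_continuous
  set c : ℂ := Complex.I * r with hcd
  have hm : Continuous fun x : ℝ => (x : ℂ) * (deriv φ x - c * φ x) := by fun_prop
  set M : L2 L := (memLp_of_continuous L hm).toLp _ with hM
  have hMn : ‖M‖ ≤ L * ‖p.2 - c • p.1‖ := by
    refine Lp.norm_le_mul_norm_of_ae_le_mul ?_
    filter_upwards [h1, h2, (memLp_of_continuous L hm).coeFn_toLp, Lp.coeFn_sub p.2 (c • p.1),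
      Lp.coeFn_smul c p.1, ae_restrict_mem measurableSet_Ioo] with x e1 e2 e3 e4 e5 hx
    rw [e3, e4, Pi.sub_apply, e5, Pi.smul_apply, e1, e2, norm_mul, Complex.norm_real,
      Real.norm_of_nonneg hx.1.le, smul_eq_mul]
    gcongr
    exact hx.2.le
  have hpn : ‖p.1‖ ^ 2 = ∫ x in Ioo 0 L, ‖φ x‖ ^ 2 := by
    have e : (inner ℂ p.1 p.1).re = ‖p.1‖ ^ 2 := inner_self_eq_norm_sq (𝕜 := ℂ) _
    rw [← e, L2.inner_def]
    refine (integral_re (L2.integrable_inner (𝕜 := ℂ) p.1 p.1)).symm.trans (integral_congr_ae ?_)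
    filter_upwards [h1] with x hx
    rw [hx]
    exact inner_self_eq_norm_sq (𝕜 := ℂ) _
  have hpM : (inner ℂ p.1 M).re = ∫ x in Ioo 0 L, x * inner ℝ (φ x) (deriv φ x) := by
    rw [L2.inner_def]
    refine (integral_re (L2.integrable_inner (𝕜 := ℂ) p.1 M)).symm.trans (integral_congr_ae ?_)
    filter_upwards [h1, (memLp_of_continuous L hm).coeFn_toLp] with x hx hx'
    rw [hx, hx', Complex.inner]
    simp [RCLike.inner_apply, hcd]
    ring
  have hi1 : Continuous fun x => ‖φ x‖ ^ 2 := by fun_prop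
  have hi2 : Continuous fun x => x * inner ℝ (φ x) (deriv φ x) :=
    continuous_id.mul (hc.inner hc')
  have key : ∫ x in (0 : ℝ)..L, (‖φ x‖ ^ 2 + 2 * (x * inner ℝ (φ x) (deriv φ x))) = 0 := by
    rw [intervalIntegral.integral_eq_sub_of_hasDerivAt (f := fun x => x * ‖φ x‖ ^ 2)]
    · rw [hφ.eq_zero (x := L) (by simp)]
      simp
    · intro x _
      refine ((hasDerivAt_id x).mul (hφ.hasDerivAt x).norm_sq).congr_deriv ?_
      simp
      ring
    · exact (hi1.add (hi2.const_mul 2)).intervalIntegrable _ _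
  rw [intervalIntegral.integral_add (hi1.intervalIntegrable _ _)
    ((hi2.const_mul 2).intervalIntegrable _ _), intervalIntegral.integral_const_mul,
    intervalIntegral.integral_of_le hL, intervalIntegral.integral_of_le hL,
    integral_Ioc_eq_integral_Ioo, integral_Ioc_eq_integral_Ioo, ← hpn, ← hpM] at key
  have h3 : -(inner ℂ p.1 M).re ≤ ‖p.1‖ * ‖M‖ := by
    have := re_inner_le_norm (𝕜 := ℂ) p.1 (-M)
    rw [inner_neg_right, norm_neg] at this
    simpa using this
  have h4 : ‖p.1‖ * ‖p.1‖ ≤ ‖p.1‖ * (2 * L * ‖p.2 - c • p.1‖) := by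
    have := mul_le_mul_of_nonneg_left hMn (norm_nonneg p.1)
    nlinarith
  rcases (norm_nonneg p.1).eq_or_lt with h | h
  · rw [← h]
    positivity
  · exact le_of_mul_le_mul_left h4 h

theorem le_of_mem_closure_testPairs {L : ℝ} {f g : L2 L × L2 L → ℝ} (hf : Continuous f)
    (hg : Continuous g) (h : ∀ p ∈ testPairs L, f p ≤ g p) {p : L2 L × L2 L}
    (hp : p ∈ (testPairs L).topologicalClosure) : f p ≤ g p :=
  closure_minimal (t := {p | f p ≤ g p}) h (isClosed_le hf hg) hp

/-- A Poincaré inequality for `u_x - i r u` on `H¹₀`. -/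
theorem norm_le_norm_dx_sub {L : ℝ} (hL : 0 ≤ L) (r : ℝ) {u : L2 L} (hu : u ∈ H10 L) :
    ‖u‖ ≤ 2 * L * ‖dx u - (Complex.I * r) • u‖ := by
  set c : ℂ := Complex.I * r
  have h1 : Continuous fun p : L2 L × L2 L => c • p.1 :=
    (continuous_const_smul c).comp continuous_fst
  have h2 : Continuous fun p : L2 L × L2 L => 2 * L * ‖p.2 - c • p.1‖ :=
    continuous_const.mul (continuous_snd.sub h1).norm
  have h3 : Continuous fun p : L2 L × L2 L => ‖p.1‖ := continuous_fst.norm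
  have h4 : ∀ p ∈ testPairs L, ‖p.1‖ ≤ 2 * L * ‖p.2 - c • p.1‖ := fun p hp =>
    norm_le_of_mem_testPairs hL r hp
  have h5 := mem_closure_testPairs hu
  have h6 := le_of_mem_closure_testPairs h3 h2 h4 h5
  exact h6

/-! ### The state space is complete -/

namespace State

variable {P : Params}

theorem le_of_mul_sq_le {k a b : ℝ} (hk : 0 < k) (ha : 0 ≤ a) (hb : 0 ≤ b)
    (h : k * a ^ 2 ≤ b ^ 2) : a ≤ (√k)⁻¹ * b := by
  rw [inv_mul_eq_div, le_div_iff₀ (Real.sqrt_pos.2 hk)]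
  refine (sq_le_sq₀ (by positivity) hb).1 ?_
  rw [mul_pow, Real.sq_sqrt hk.le]
  linarith

theorem exists_bound_energy (P : Params) : ∃ C : ℝ, 0 ≤ C ∧ ∀ U : State P,
    ‖U.shear‖ ≤ C * ‖U‖ ∧ ‖U.axial‖ ≤ C * ‖U‖ ∧ ‖dx U.v3‖ ≤ C * ‖U‖ ∧
    ‖U.v2‖ ≤ C * ‖U‖ ∧ ‖U.v4‖ ≤ C * ‖U‖ ∧ ‖U.v6‖ ≤ C * ‖U‖ := by
  have a1 := P.k₁_pos
  have a2 := P.k₂_pos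
  have a3 := P.k₃_pos
  have b1 := P.ρ₁_pos
  have b2 := P.ρ₂_pos
  refine ⟨(√P.k₁)⁻¹ + (√P.k₂)⁻¹ + (√P.k₃)⁻¹ + (√P.ρ₁)⁻¹ + (√P.ρ₂)⁻¹, by positivity, fun U => ?_⟩
  have h := norm_sq_eq U
  have key : ∀ {k : ℝ} (u : L2 P.L), 0 < k → k * ‖u‖ ^ 2 ≤ ‖U‖ ^ 2 →
      (√k)⁻¹ ≤ (√P.k₁)⁻¹ + (√P.k₂)⁻¹ + (√P.k₃)⁻¹ + (√P.ρ₁)⁻¹ + (√P.ρ₂)⁻¹ →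
      ‖u‖ ≤ ((√P.k₁)⁻¹ + (√P.k₂)⁻¹ + (√P.k₃)⁻¹ + (√P.ρ₁)⁻¹ + (√P.ρ₂)⁻¹) * ‖U‖ :=
    fun u hk hu hC => (le_of_mul_sq_le hk (norm_nonneg _) (norm_nonneg _) hu).trans
      (mul_le_mul_of_nonneg_right hC (norm_nonneg _))
  have c1 : 0 ≤ P.k₁ * ‖U.shear‖ ^ 2 := by positivity
  have c2 : 0 ≤ P.ρ₁ * ‖U.v2‖ ^ 2 := by positivity
  have c3 : 0 ≤ P.k₂ * ‖dx U.v3‖ ^ 2 := by positivity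
  have c4 : 0 ≤ P.ρ₂ * ‖U.v4‖ ^ 2 := by positivity
  have c5 : 0 ≤ P.k₃ * ‖U.axial‖ ^ 2 := by positivity
  have c6 : 0 ≤ P.ρ₁ * ‖U.v6‖ ^ 2 := by positivity
  have d1 : 0 ≤ (√P.k₁)⁻¹ := by positivity
  have d2 : 0 ≤ (√P.k₂)⁻¹ := by positivity
  have d3 : 0 ≤ (√P.k₃)⁻¹ := by positivity
  have d4 : 0 ≤ (√P.ρ₁)⁻¹ := by positivity
  have d5 : 0 ≤ (√P.ρ₂)⁻¹ := by positivity
  exact ⟨key _ a1 (by linarith) (by linarith), key _ a3 (by linarith) (by linarith),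
    key _ a2 (by linarith) (by linarith), key _ b1 (by linarith) (by linarith),
    key _ b2 (by linarith) (by linarith), key _ b1 (by linarith) (by linarith)⟩

theorem norm_v3_le (U : State P) : ‖U.v3‖ ≤ 2 * P.L * ‖dx U.v3‖ := by
  simpa using norm_le_norm_dx_sub P.L_pos.le 0 U.v3_mem

theorem norm_v1_add_smul_v5_le (U : State P) {σ : ℝ} (hσ : σ * σ = 1) :
    ‖U.v1 + (Complex.I * σ) • U.v5‖ ≤
      2 * P.L * ‖U.shear - U.v3 + (Complex.I * σ) • U.axial‖ := by
  have h := norm_le_norm_dx_sub P.L_pos.le (σ * P.l)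
    (add_mem U.v1_mem (Submodule.smul_mem _ (Complex.I * σ) U.v5_mem))
  rw [dx_add U.v1_mem_H1 (Submodule.smul_mem _ _ U.v5_mem_H1), dx_smul _ U.v5_mem_H1] at h
  have e : dx U.v1 + (Complex.I * σ) • dx U.v5 -
      (Complex.I * ((σ * P.l : ℝ) : ℂ)) • (U.v1 + (Complex.I * σ) • U.v5) =
      U.shear - U.v3 + (Complex.I * σ) • U.axial := by
    have h1 : (Complex.I * ((σ * P.l : ℝ) : ℂ)) * (Complex.I * σ) = -P.l := by
      have h2 : (σ : ℂ) * σ = 1 := by exact_mod_cast hσ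
      push_cast
      linear_combination (P.l : ℂ) * σ * σ * Complex.I_mul_I - (P.l : ℂ) * h2
    rw [smul_add, smul_smul, h1, shear, axial]
    push_cast
    module
  rwa [e] at h

theorem exists_bound_v1_v5 (P : Params) : ∃ C : ℝ, 0 ≤ C ∧ ∀ U : State P,
    ‖U.v1‖ ≤ C * ‖U‖ ∧ ‖U.v5‖ ≤ C * ‖U‖ ∧ ‖U.v3‖ ≤ C * ‖U‖ := by
  obtain ⟨C, hC, h⟩ := exists_bound_energy P
  have hL := P.L_pos
  set C' := 2 * P.L * (C + 2 * P.L * C + C) with hC'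
  have hC0 : 0 ≤ C' := by positivity
  refine ⟨C' + 2 * P.L * C, by positivity, fun U => ?_⟩
  obtain ⟨h1, h2, h3, -⟩ := h U
  have hv3 : ‖U.v3‖ ≤ 2 * P.L * C * ‖U‖ := by
    refine (norm_v3_le U).trans ?_
    rw [mul_assoc _ C]
    gcongr
  have hw : ∀ σ : ℝ, |σ| = 1 → σ * σ = 1 →
      ‖U.v1 + (Complex.I * σ) • U.v5‖ ≤ C' * ‖U‖ := by
    intro σ hσ hσ'
    refine (norm_v1_add_smul_v5_le U hσ').trans ?_
    rw [hC', mul_assoc _ (C + _ + C)]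
    gcongr
    refine (norm_add_le _ _).trans ?_
    have e : ‖(Complex.I * σ) • U.axial‖ = ‖U.axial‖ := by
      rw [norm_smul, norm_mul, Complex.norm_I, Complex.norm_real, Real.norm_eq_abs, hσ]
      ring
    rw [e]
    linarith [norm_sub_le U.shear U.v3]
  have hp := hw 1 (by simp) (by simp)
  have hm := hw (-1) (by simp) (by simp)
  have e1 : (2 : ℂ) • U.v1 = (U.v1 + (Complex.I * (1 : ℝ)) • U.v5) +
      (U.v1 + (Complex.I * (-1 : ℝ)) • U.v5) := by push_cast; module
  have e5 : (2 * Complex.I) • U.v5 = (U.v1 + (Complex.I * (1 : ℝ)) • U.v5) -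
      (U.v1 + (Complex.I * (-1 : ℝ)) • U.v5) := by push_cast; module
  have n1 := norm_add_le (U.v1 + (Complex.I * (1 : ℝ)) • U.v5)
    (U.v1 + (Complex.I * (-1 : ℝ)) • U.v5)
  have n5 := norm_sub_le (U.v1 + (Complex.I * (1 : ℝ)) • U.v5)
    (U.v1 + (Complex.I * (-1 : ℝ)) • U.v5)
  rw [← e1, norm_smul] at n1
  rw [← e5, norm_smul] at n5
  simp only [norm_mul, Complex.norm_I, Complex.norm_ofNat, mul_one] at n1 n5
  have z1 : 0 ≤ 2 * P.L * C * ‖U‖ := by positivity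
  have z2 : 0 ≤ C' * ‖U‖ := by positivity
  refine ⟨?_, ?_, ?_⟩ <;> linarith

theorem exists_bound_dx (P : Params) : ∃ C : ℝ, 0 ≤ C ∧ ∀ U : State P,
    ‖dx U.v1‖ ≤ C * ‖U‖ ∧ ‖dx U.v5‖ ≤ C * ‖U‖ := by
  obtain ⟨C, hC, h⟩ := exists_bound_energy P
  obtain ⟨D, hD, h'⟩ := exists_bound_v1_v5 P
  have hl := P.l_pos
  refine ⟨C + D + P.l * D, by positivity, fun U => ?_⟩
  obtain ⟨h1, h2, -⟩ := h U
  obtain ⟨g1, g5, g3⟩ := h' U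
  have n : ∀ u : L2 P.L, ‖(P.l : ℂ) • u‖ = P.l * ‖u‖ := fun u => by
    rw [norm_smul, Complex.norm_real, Real.norm_of_nonneg hl.le]
  have e1 : dx U.v1 = U.shear - U.v3 - (P.l : ℂ) • U.v5 := by rw [shear]; abel
  have e5 : dx U.v5 = U.axial + (P.l : ℂ) • U.v1 := by rw [axial]; abel
  have f1 := norm_sub_le (U.shear - U.v3) ((P.l : ℂ) • U.v5)
  have f2 := norm_sub_le U.shear U.v3
  have f5 := norm_add_le U.axial ((P.l : ℂ) • U.v1)
  rw [n] at f1 f5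
  rw [e1, e5]
  have z1 : 0 ≤ D * ‖U‖ := by positivity
  constructor
  · nlinarith
  · nlinarith

end State

namespace State

variable {P : Params}

/-! Components of a state, their derivatives and the axial strain as bounded operators. -/

def v1L (P : Params) : State P →L[ℂ] L2 P.L :=
  LinearMap.mkContinuousOfExistsBound ⟨⟨v1, v1_add⟩, v1_smul⟩
    ((exists_bound_v1_v5 P).imp fun _ h U => (h.2 U).1)

def v2L (P : Params) : State P →L[ℂ] L2 P.L :=
  LinearMap.mkContinuousOfExistsBound ⟨⟨v2, v2_add⟩, v2_smul⟩
    ((exists_bound_energy P).imp fun _ h U => (h.2 U).2.2.2.1)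

def v3L (P : Params) : State P →L[ℂ] L2 P.L :=
  LinearMap.mkContinuousOfExistsBound ⟨⟨v3, v3_add⟩, v3_smul⟩
    ((exists_bound_v1_v5 P).imp fun _ h U => (h.2 U).2.2)

def v4L (P : Params) : State P →L[ℂ] L2 P.L :=
  LinearMap.mkContinuousOfExistsBound ⟨⟨v4, v4_add⟩, v4_smul⟩
    ((exists_bound_energy P).imp fun _ h U => (h.2 U).2.2.2.2.1)

def v5L (P : Params) : State P →L[ℂ] L2 P.L :=
  LinearMap.mkContinuousOfExistsBound ⟨⟨v5, v5_add⟩, v5_smul⟩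
    ((exists_bound_v1_v5 P).imp fun _ h U => (h.2 U).2.1)

def v6L (P : Params) : State P →L[ℂ] L2 P.L :=
  LinearMap.mkContinuousOfExistsBound ⟨⟨v6, v6_add⟩, v6_smul⟩
    ((exists_bound_energy P).imp fun _ h U => (h.2 U).2.2.2.2.2)

def axialL (P : Params) : State P →L[ℂ] L2 P.L :=
  LinearMap.mkContinuousOfExistsBound ⟨⟨axial, axial_add⟩, axial_smul⟩
    ((exists_bound_energy P).imp fun _ h U => (h.2 U).2.1)

def dxv1L (P : Params) : State P →L[ℂ] L2 P.L :=
  LinearMap.mkContinuousOfExistsBound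
    ⟨⟨fun U => dx U.v1, fun U V => dx_add U.v1_mem_H1 V.v1_mem_H1⟩,
      fun c U => dx_smul c U.v1_mem_H1⟩
    ((exists_bound_dx P).imp fun _ h U => (h.2 U).1)

def dxv3L (P : Params) : State P →L[ℂ] L2 P.L :=
  LinearMap.mkContinuousOfExistsBound
    ⟨⟨fun U => dx U.v3, fun U V => dx_add U.v3_mem_H1 V.v3_mem_H1⟩,
      fun c U => dx_smul c U.v3_mem_H1⟩
    ((exists_bound_energy P).imp fun _ h U => (h.2 U).2.2.1)

def dxv5L (P : Params) : State P →L[ℂ] L2 P.L :=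
  LinearMap.mkContinuousOfExistsBound
    ⟨⟨fun U => dx U.v5, fun U V => dx_add U.v5_mem_H1 V.v5_mem_H1⟩,
      fun c U => dx_smul c U.v5_mem_H1⟩
    ((exists_bound_dx P).imp fun _ h U => (h.2 U).2)

theorem shear_sub (U V : State P) : (U - V).shear = U.shear - V.shear := by
  rw [sub_eq_add_neg, ← neg_one_smul ℂ V, shear_add, shear_smul, neg_one_smul, sub_eq_add_neg]

/-- Convergence of all components with finite energy implies convergence of states. -/
theorem tendsto_of_components {ι : Type*} {l : Filter ι} {u : ι → State P} {U : State P}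
    (h1 : Tendsto (fun i => (u i).v1) l (𝓝 U.v1)) (h2 : Tendsto (fun i => (u i).v2) l (𝓝 U.v2))
    (h3 : Tendsto (fun i => (u i).v3) l (𝓝 U.v3)) (h4 : Tendsto (fun i => (u i).v4) l (𝓝 U.v4))
    (h5 : Tendsto (fun i => (u i).v5) l (𝓝 U.v5)) (h6 : Tendsto (fun i => (u i).v6) l (𝓝 U.v6))
    (d1 : Tendsto (fun i => dx (u i).v1) l (𝓝 (dx U.v1)))
    (d3 : Tendsto (fun i => dx (u i).v3) l (𝓝 (dx U.v3)))
    (d5 : Tendsto (fun i => dx (u i).v5) l (𝓝 (dx U.v5))) : Tendsto u l (𝓝 U) := by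
  have hs : Tendsto (fun i => (u i).shear) l (𝓝 U.shear) :=
    (d1.add h3).add (h5.const_smul (P.l : ℂ))
  have ha : Tendsto (fun i => (u i).axial) l (𝓝 U.axial) := d5.sub (h1.const_smul (P.l : ℂ))
  have key : ∀ (k : ℝ) {w : ι → L2 P.L} {z : L2 P.L}, Tendsto w l (𝓝 z) →
      Tendsto (fun i => k * ‖w i - z‖ ^ 2) l (𝓝 0) := by
    intro k w z h
    simpa using ((tendsto_iff_norm_sub_tendsto_zero.1 h).pow 2).const_mul k
  have hsum := (((((key P.k₁ hs).add (key P.ρ₁ h2)).add (key P.k₂ d3)).add (key P.ρ₂ h4)).add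
    (key P.k₃ ha)).add (key P.ρ₁ h6)
  have hsq : Tendsto (fun i => ‖u i - U‖ ^ 2) l (𝓝 0) := by
    simp only [add_zero] at hsum
    refine hsum.congr fun i => ?_
    have e2 : (u i - U).v2 = (u i).v2 - U.v2 := map_sub (v2L P) _ _
    have e3 : dx (u i - U).v3 = dx (u i).v3 - dx U.v3 := map_sub (dxv3L P) _ _
    have e4 : (u i - U).v4 = (u i).v4 - U.v4 := map_sub (v4L P) _ _
    have e6 : (u i - U).v6 = (u i).v6 - U.v6 := map_sub (v6L P) _ _
    have ea : (u i - U).axial = (u i).axial - U.axial := map_sub (axialL P) _ _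
    rw [norm_sq_eq, shear_sub, e2, e3, e4, e6, ea]
  rw [tendsto_iff_norm_sub_tendsto_zero]
  have := (Real.continuous_sqrt.tendsto 0).comp hsq
  rw [Real.sqrt_zero] at this
  refine this.congr fun i => ?_
  simp

instance : CompleteSpace (State P) := by
  refine Metric.complete_of_cauchySeq_tendsto fun u hu => ?_
  have lim : ∀ T : State P →L[ℂ] L2 P.L, ∃ a, Tendsto (fun n => T (u n)) atTop (𝓝 a) := fun T =>
    cauchySeq_tendsto_of_complete (hu.map T.uniformContinuous)
  have hK : ∀ {w : ℕ → L2 P.L} {a b : L2 P.L}, (∀ n, w n ∈ H10 P.L) → Tendsto w atTop (𝓝 a) →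
      Tendsto (fun n => dx (w n)) atTop (𝓝 b) → a ∈ H10 P.L ∧ dx a = b := by
    intro w a b hw ha hb
    refine mem_H10_of_mem_closure ?_
    exact (testPairs P.L).isClosed_topologicalClosure.mem_of_tendsto (ha.prodMk_nhds hb)
      (Eventually.of_forall fun n => mem_closure_testPairs (hw n))
  obtain ⟨a1, h1⟩ := lim (v1L P)
  obtain ⟨a2, h2⟩ := lim (v2L P)
  obtain ⟨a3, h3⟩ := lim (v3L P)
  obtain ⟨a4, h4⟩ := lim (v4L P)
  obtain ⟨a5, h5⟩ := lim (v5L P)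
  obtain ⟨a6, h6⟩ := lim (v6L P)
  obtain ⟨b1, d1⟩ := lim (dxv1L P)
  obtain ⟨b3, d3⟩ := lim (dxv3L P)
  obtain ⟨b5, d5⟩ := lim (dxv5L P)
  obtain ⟨m1, rfl⟩ := hK (fun n => (u n).v1_mem) h1 d1
  obtain ⟨m3, rfl⟩ := hK (fun n => (u n).v3_mem) h3 d3
  obtain ⟨m5, rfl⟩ := hK (fun n => (u n).v5_mem) h5 d5
  exact ⟨((⟨a1, m1⟩, a2), (⟨a3, m3⟩, a4), (⟨a5, m5⟩, a6)),
    tendsto_of_components h1 h2 h3 h4 h5 h6 d1 d3 d5⟩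

end State

/-! ### Multiplication by the damping coefficient -/

theorem inner_dMul_left (P : Params) (u v : L2 P.L) :
    inner ℂ (P.dMul u) v = inner ℂ u (P.dMul v) := by
  rw [L2.inner_def, L2.inner_def]
  refine integral_congr_ae ?_
  filter_upwards [(memLp_d_mul P u).coeFn_toLp, (memLp_d_mul P v).coeFn_toLp] with x hu hv
  rw [Params.dMul, LinearMap.coe_mk, AddHom.coe_mk, hu, hv]
  simp [RCLike.inner_apply]
  ring

theorem dMul_dMul (P : Params) (u : L2 P.L) : P.dMul (P.dMul u) = (P.d₀ : ℂ) • P.dMul u := by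
  refine Lp.ext ?_
  filter_upwards [(memLp_d_mul P u).coeFn_toLp, (memLp_d_mul P (P.dMul u)).coeFn_toLp,
    Lp.coeFn_smul (P.d₀ : ℂ) (P.dMul u)] with x h1 h2 h3
  rw [h3, Pi.smul_apply]
  rw [Params.dMul, LinearMap.coe_mk, AddHom.coe_mk] at *
  rw [h2, h1]
  by_cases hx : x ∈ Ioo P.α P.β <;> simp [Params.d, hx]

theorem inner_dMul_dMul (P : Params) (u v : L2 P.L) :
    inner ℂ (P.dMul u) (P.dMul v) = P.d₀ * inner ℂ u (P.dMul v) := by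
  rw [inner_dMul_left, dMul_dMul, inner_smul_right]

theorem re_inner_dMul_nonneg (P : Params) (u : L2 P.L) : 0 ≤ (inner ℂ u (P.dMul u)).re := by
  have h : (inner ℂ (P.dMul u) (P.dMul u)).re = ‖P.dMul u‖ ^ 2 :=
    inner_self_eq_norm_sq (𝕜 := ℂ) _
  rw [inner_dMul_dMul, Complex.re_ofReal_mul] at h
  have := P.d₀_pos
  by_contra hlt
  have := mul_neg_of_pos_of_neg this (not_le.1 hlt)
  nlinarith [sq_nonneg ‖P.dMul u‖]

theorem norm_dMul_le (P : Params) (u : L2 P.L) : ‖P.dMul u‖ ≤ P.d₀ * ‖u‖ := by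
  refine Lp.norm_le_mul_norm_of_ae_le_mul ?_
  filter_upwards [(memLp_d_mul P u).coeFn_toLp] with x h
  rw [Params.dMul, LinearMap.coe_mk, AddHom.coe_mk, h, norm_mul]
  gcongr
  have := P.d₀_pos
  by_cases hx : x ∈ Ioo P.α P.β <;> simp [Params.d, hx, abs_of_pos this, this.le]

/-- Multiplication by `d(x)` as a bounded operator. -/
def dMulL (P : Params) : L2 P.L →L[ℂ] L2 P.L := P.dMul.mkContinuous P.d₀ (norm_dMul_le P)

/-- The Bresse operator is dissipative. -/
theorem re_inner_opFun_nonpos {P : Params} (U : State P) (hU : MemDomain P U) :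
    (inner ℂ U (opFun U hU)).re ≤ 0 := by
  have hρ₁ : (P.ρ₁ : ℂ) ≠ 0 := by exact_mod_cast P.ρ₁_pos.ne'
  have hρ₂ : (P.ρ₂ : ℂ) ≠ 0 := by exact_mod_cast P.ρ₂_pos.ne'
  set w := dx U.v6 - (P.l : ℂ) • U.v2 with hw
  have i2 := inner_dx_left hU.v2_mem (shear_mem_H1 hU)
  have i4 := inner_dx_left hU.v4_mem hU.v3_mem.2
  have i6 := inner_dx_left hU.v6_mem (force_mem_H1 hU)
  have es : (opFun U hU).shear = dx U.v2 + U.v4 + (P.l : ℂ) • U.v6 := rfl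
  have ea : (opFun U hU).axial = w := rfl
  have e2 : (P.ρ₁ : ℂ) * inner ℂ U.v2 (opFun U hU).v2 = P.k₁ * inner ℂ U.v2 (dx U.shear)
      + P.l * P.k₃ * inner ℂ U.v2 U.axial + P.l * inner ℂ U.v2 (P.dMul w) := by
    show (P.ρ₁ : ℂ) * inner ℂ U.v2 (row2 U) = _
    rw [row2, inner_add_right, inner_add_right, inner_smul_right, inner_smul_right,
      inner_smul_right, ← hw]
    field_simp
  have e4 : (P.ρ₂ : ℂ) * inner ℂ U.v4 (opFun U hU).v4 = P.k₂ * inner ℂ U.v4 (dx (dx U.v3))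
      - P.k₁ * inner ℂ U.v4 U.shear := by
    show (P.ρ₂ : ℂ) * inner ℂ U.v4 (row4 U) = _
    rw [row4, inner_sub_right, inner_smul_right, inner_smul_right]
    field_simp
  have e6 : (P.ρ₁ : ℂ) * inner ℂ U.v6 (opFun U hU).v6 = inner ℂ U.v6 (dx U.force)
      - P.l * P.k₁ * inner ℂ U.v6 U.shear := by
    show (P.ρ₁ : ℂ) * inner ℂ U.v6 (row6 U) = _
    rw [row6, inner_sub_right, inner_smul_right, inner_smul_right]
    field_simp
  have e3 : dx (opFun U hU).v3 = dx U.v4 := rfl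
  have ef : inner ℂ (dx U.v6) U.force = P.k₃ * inner ℂ (dx U.v6) U.axial
      + inner ℂ (dx U.v6) (P.dMul w) := by
    rw [State.force, inner_add_right, inner_smul_right]
  have ew : ∀ z, inner ℂ w z = inner ℂ (dx U.v6) z - P.l * inner ℂ U.v2 z := by
    intro z
    rw [hw, inner_sub_left, inner_smul_left, Complex.conj_ofReal]
  have key : inner ℂ U (opFun U hU) =
      P.k₁ * (inner ℂ U.shear (dx U.v2) - inner ℂ (dx U.v2) U.shear)
      + P.k₁ * (inner ℂ U.shear U.v4 - inner ℂ U.v4 U.shear)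
      + (P.l * P.k₁ : ℝ) * (inner ℂ U.shear U.v6 - inner ℂ U.v6 U.shear)
      + P.k₂ * (inner ℂ (dx U.v3) (dx U.v4) - inner ℂ (dx U.v4) (dx U.v3))
      + P.k₃ * (inner ℂ U.axial w - inner ℂ w U.axial) - inner ℂ w (P.dMul w) := by
    rw [State.inner_eq, State.energyInner, es, ea, e2, e4, e6, e3, inner_add_right, inner_add_right,
      inner_smul_right, ew U.axial, ew (P.dMul w)]
    push_cast
    linear_combination (P.k₁ : ℂ) * i2 + P.k₂ * i4 + i6 - ef
  have z : ∀ (k : ℝ) (x y : L2 P.L), ((k : ℂ) * (inner ℂ x y - inner ℂ y x)).re = 0 := by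
    intro k x y
    have : (inner ℂ x y).re = (inner ℂ y x).re := inner_re_symm (𝕜 := ℂ) x y
    rw [Complex.re_ofReal_mul, Complex.sub_re, this, sub_self, mul_zero]
  rw [key]
  simp only [Complex.add_re, Complex.sub_re _ (inner ℂ w (P.dMul w)), z]
  linarith [re_inner_dMul_nonneg P w]

open State

/-! ### Range of `1 - 𝓐` -/

/-- Solvability of the variational problem for the form `(φ, v) + (T φ, T v)` on a closed
subspace. -/
theorem exists_variational {E F : Type*} [NormedAddCommGroup E] [InnerProductSpace ℂ E]
    [CompleteSpace E] [NormedAddCommGroup F] [InnerProductSpace ℂ F] [CompleteSpace F]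
    (K : Submodule ℂ E) (hK : IsClosed (K : Set E)) (T : E →L[ℂ] F) (G : E) (h : F) :
    ∃ v ∈ K, ∀ φ ∈ K, inner ℂ φ v + inner ℂ (T φ) (T v) = inner ℂ φ G + inner ℂ (T φ) h := by
  let Λ : Submodule ℂ (WithLp 2 (E × F)) :=
    { carrier := {p | p.fst ∈ K ∧ p.snd = T p.fst}
      add_mem' := fun {p q} hp hq => ⟨add_mem hp.1 hq.1, by
        rw [WithLp.add_snd, WithLp.add_fst, map_add, hp.2, hq.2]⟩
      zero_mem' := ⟨zero_mem K, by simp⟩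
      smul_mem' := fun c p hp => ⟨Submodule.smul_mem _ c hp.1, by
        rw [WithLp.smul_snd, WithLp.smul_fst, map_smul, hp.2]⟩ }
  have hfst : Continuous fun p : WithLp 2 (E × F) => p.fst := by fun_prop
  have hsnd : Continuous fun p : WithLp 2 (E × F) => p.snd := by fun_prop
  have hΛ : IsClosed (Λ : Set (WithLp 2 (E × F))) :=
    (hK.preimage hfst).inter (isClosed_eq hsnd (T.continuous.comp hfst))
  have : CompleteSpace Λ := hΛ.completeSpace_coe
  set x : WithLp 2 (E × F) := WithLp.toLp 2 (G, h)
  obtain ⟨hv, hTv⟩ := Λ.starProjection_apply_mem x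
  refine ⟨(Λ.starProjection x).fst, hv, fun φ hφ => ?_⟩
  have hq : WithLp.toLp 2 (φ, T φ) ∈ Λ := ⟨hφ, rfl⟩
  have h1 := (Submodule.mem_orthogonal _ _).1 (Λ.sub_starProjection_mem_orthogonal x) _ hq
  rw [inner_sub_right, sub_eq_zero, WithLp.prod_inner_apply, WithLp.prod_inner_apply] at h1
  have hTv' : (Λ.starProjection x).snd = T (Λ.starProjection x).fst := hTv
  rw [← hTv']
  exact h1.symm

variable {P : Params}

/-- The states of the form `(φ₁, φ₁, φ₃, φ₃, φ₅, φ₅)`. -/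
def diagonal (P : Params) : Submodule ℂ (State P) where
  carrier := {U | U.v2 = U.v1 ∧ U.v4 = U.v3 ∧ U.v6 = U.v5}
  add_mem' := fun {U V} hU hV => ⟨by simp [hU.1, hV.1], by simp [hU.2.1, hV.2.1],
    by simp [hU.2.2, hV.2.2]⟩
  zero_mem' := ⟨rfl, rfl, rfl⟩
  smul_mem' := fun c U hU => ⟨by simp [hU.1], by simp [hU.2.1], by simp [hU.2.2]⟩

theorem isClosed_diagonal (P : Params) : IsClosed (diagonal P : Set (State P)) :=
  (isClosed_eq (v2L P).continuous (v1L P).continuous).inter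
    ((isClosed_eq (v4L P).continuous (v3L P).continuous).inter
      (isClosed_eq (v6L P).continuous (v5L P).continuous))

/-- The weak form of `U - 𝓐 U = F` after elimination of the velocities. -/
theorem exists_weak_resolvent (F : State P) : ∃ V : State P,
    ∀ φ₁ ∈ H10 P.L, ∀ φ₃ ∈ H10 P.L, ∀ φ₅ ∈ H10 P.L,
      P.k₁ * inner ℂ (dx φ₁ + φ₃ + (P.l : ℂ) • φ₅) V.shear
      + P.ρ₁ * inner ℂ φ₁ (V.v1 - F.v1 - F.v2)
      + P.k₂ * inner ℂ (dx φ₃) (dx V.v3) + P.ρ₂ * inner ℂ φ₃ (V.v3 - F.v3 - F.v4)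
      + P.k₃ * inner ℂ (dx φ₅ - (P.l : ℂ) • φ₁) V.axial
      + P.ρ₁ * inner ℂ φ₅ (V.v5 - F.v5 - F.v6)
      + inner ℂ (dx φ₅ - (P.l : ℂ) • φ₁) (P.dMul (V.axial - F.axial)) = 0 := by
  have hd := P.d₀_pos
  set c : ℂ := (((√P.d₀)⁻¹ : ℝ) : ℂ) with hc
  have hcc : c * c * P.d₀ = 1 := by
    rw [hc, ← Complex.ofReal_mul, ← Complex.ofReal_mul, ← mul_inv, Real.mul_self_sqrt hd.le,
      inv_mul_cancel₀ hd.ne', Complex.ofReal_one]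
  have hT : ∀ u v : L2 P.L, inner ℂ (c • P.dMul u) (c • P.dMul v) = inner ℂ u (P.dMul v) := by
    intro u v
    rw [inner_smul_left, inner_smul_right, inner_dMul_dMul, hc, Complex.conj_ofReal, ← hc]
    linear_combination inner ℂ u (P.dMul v) * hcc
  obtain ⟨Z, z1, z2, z3, z4, z5, z6⟩ : ∃ Z : State P, Z.v1 = 0 ∧ Z.v2 = F.v1 + F.v2 ∧ Z.v3 = 0 ∧
      Z.v4 = F.v3 + F.v4 ∧ Z.v5 = 0 ∧ Z.v6 = F.v5 + F.v6 :=
    ⟨((0, F.v1 + F.v2), (0, F.v3 + F.v4), (0, F.v5 + F.v6)), rfl, rfl, rfl, rfl, rfl, rfl⟩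
  obtain ⟨V, hV, h⟩ := exists_variational (diagonal P) (isClosed_diagonal P)
    (c • (dMulL P).comp (axialL P)) Z (c • P.dMul F.axial)
  refine ⟨V, fun φ₁ h₁ φ₃ h₃ φ₅ h₅ => ?_⟩
  set Φ : State P := ((⟨φ₁, h₁⟩, φ₁), (⟨φ₃, h₃⟩, φ₃), (⟨φ₅, h₅⟩, φ₅)) with hΦ
  have h0 := h Φ ⟨rfl, rfl, rfl⟩
  have e1 : inner ℂ ((c • (dMulL P).comp (axialL P)) Φ) ((c • (dMulL P).comp (axialL P)) V) =
      inner ℂ Φ.axial (P.dMul V.axial) := hT _ _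
  have e2 : inner ℂ ((c • (dMulL P).comp (axialL P)) Φ) (c • P.dMul F.axial) =
      inner ℂ Φ.axial (P.dMul F.axial) := hT _ _
  rw [e1, e2] at h0
  obtain ⟨g2, g4, g6⟩ := hV
  have e3 : inner ℂ Φ V = P.k₁ * inner ℂ (dx φ₁ + φ₃ + (P.l : ℂ) • φ₅) V.shear
      + P.ρ₁ * inner ℂ φ₁ V.v1 + P.k₂ * inner ℂ (dx φ₃) (dx V.v3) + P.ρ₂ * inner ℂ φ₃ V.v3
      + P.k₃ * inner ℂ (dx φ₅ - (P.l : ℂ) • φ₁) V.axial + P.ρ₁ * inner ℂ φ₅ V.v5 := by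
    rw [State.inner_eq, State.energyInner, g2, g4, g6]
    rfl
  have e4 : inner ℂ Φ Z = P.ρ₁ * inner ℂ φ₁ (F.v1 + F.v2) + P.ρ₂ * inner ℂ φ₃ (F.v3 + F.v4)
      + P.ρ₁ * inner ℂ φ₅ (F.v5 + F.v6) := by
    have zs : Z.shear = 0 := by rw [shear, z1, z3, z5, dx_zero]; simp
    have za : Z.axial = 0 := by rw [axial, z1, z5, dx_zero]; simp
    rw [State.inner_eq, State.energyInner, zs, za, z2, z3, z4, z6, dx_zero, inner_zero_right,
      inner_zero_right, inner_zero_right, mul_zero, mul_zero, mul_zero, zero_add, add_zero,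
      add_zero]
    rfl
  rw [e3, e4] at h0
  have ea : Φ.axial = dx φ₅ - (P.l : ℂ) • φ₁ := rfl
  rw [ea] at h0
  rw [map_sub, inner_sub_right _ (P.dMul V.axial)]
  simp only [sub_sub, inner_sub_right _ _ (_ + _)]
  linear_combination h0

theorem exists_sub_opFun_eq (F : State P) :
    ∃ (U : State P) (hU : MemDomain P U), U - opFun U hU = F := by
  have hρ₁ : (P.ρ₁ : ℂ) ≠ 0 := by exact_mod_cast P.ρ₁_pos.ne'
  have hρ₂ : (P.ρ₂ : ℂ) ≠ 0 := by exact_mod_cast P.ρ₂_pos.ne'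
  have hk₁ : (P.k₁ : ℂ) ≠ 0 := by exact_mod_cast P.k₁_pos.ne'
  have hk₂ : (P.k₂ : ℂ) ≠ 0 := by exact_mod_cast P.k₂_pos.ne'
  obtain ⟨V, h⟩ := exists_weak_resolvent F
  set W := P.dMul (V.axial - F.axial) with hW
  set U : State P := ((⟨V.v1, V.v1_mem⟩, V.v1 - F.v1), (⟨V.v3, V.v3_mem⟩, V.v3 - F.v3),
    (⟨V.v5, V.v5_mem⟩, V.v5 - F.v5)) with hU
  have u1 : U.v1 = V.v1 := rfl
  have u2 : U.v2 = V.v1 - F.v1 := rfl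
  have u3 : U.v3 = V.v3 := rfl
  have u4 : U.v4 = V.v3 - F.v3 := rfl
  have u6 : U.v6 = V.v5 - F.v5 := rfl
  have us : U.shear = V.shear := rfl
  have ua : U.axial = V.axial := rfl
  have uw : P.dMul (dx U.v6 - (P.l : ℂ) • U.v2) = W := by
    rw [hW, u6, u2, dx_sub V.v5_mem_H1 F.v5_mem_H1]
    congr 1
    simp only [axial]
    module
  have uf : U.force = (P.k₃ : ℂ) • V.axial + W := by rw [force, uw, ua]
  have w1 : IsWeakDeriv P.L V.shear ((P.k₁ : ℂ)⁻¹ • ((P.ρ₁ : ℂ) • (V.v1 - F.v1 - F.v2)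
      - (P.l * P.k₃ : ℂ) • V.axial - (P.l : ℂ) • W)) := by
    refine isWeakDeriv_of_forall_H10 fun φ hφ => ?_
    have := h φ hφ 0 (zero_mem _) 0 (zero_mem _)
    simp only [dx_zero, smul_zero, add_zero, inner_zero_left, mul_zero, zero_sub, inner_neg_left,
      inner_smul_left, Complex.conj_ofReal] at this
    simp only [inner_smul_right, inner_sub_right _ _ (_ • _)]
    field_simp
    linear_combination this
  have w3 : IsWeakDeriv P.L (dx V.v3) ((P.k₂ : ℂ)⁻¹ • ((P.ρ₂ : ℂ) • (V.v3 - F.v3 - F.v4)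
      + (P.k₁ : ℂ) • V.shear)) := by
    refine isWeakDeriv_of_forall_H10 fun φ hφ => ?_
    have := h 0 (zero_mem _) φ hφ 0 (zero_mem _)
    simp only [dx_zero, smul_zero, add_zero, inner_zero_left, mul_zero, sub_zero, zero_add] at this
    simp only [inner_smul_right, inner_add_right]
    field_simp
    linear_combination this
  have w5 : IsWeakDeriv P.L U.force ((P.ρ₁ : ℂ) • (V.v5 - F.v5 - F.v6)
      + (P.l * P.k₁ : ℂ) • V.shear) := by
    refine isWeakDeriv_of_forall_H10 fun φ hφ => ?_
    have := h 0 (zero_mem _) 0 (zero_mem _) φ hφ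
    simp only [dx_zero, smul_zero, add_zero, inner_zero_left, mul_zero, sub_zero, zero_add,
      inner_smul_left, Complex.conj_ofReal] at this
    rw [uf]
    simp only [inner_smul_right, inner_add_right]
    linear_combination this
  have m1 : V.v1 ∈ H2 P.L := by
    refine ⟨V.v1_mem_H1, ?_⟩
    have e : dx V.v1 = V.shear - V.v3 - (P.l : ℂ) • V.v5 := by rw [shear]; abel
    rw [e]
    exact sub_mem (sub_mem ⟨_, w1⟩ V.v3_mem_H1) (Submodule.smul_mem _ _ V.v5_mem_H1)
  have mf : U.domForce ∈ H1 P.L := by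
    have e : U.domForce = U.force + (P.k₃ : ℂ) • (P.l : ℂ) • U.v1 := by rw [force_eq]; abel
    rw [e]
    exact add_mem ⟨_, w5⟩ (Submodule.smul_mem _ _ (Submodule.smul_mem _ _ U.v1_mem_H1))
  have hD : MemDomain P U := ⟨m1, ⟨V.v3_mem_H1, ⟨_, w3⟩⟩, sub_mem V.v1_mem F.v1_mem,
    sub_mem V.v3_mem F.v3_mem, sub_mem V.v5_mem F.v5_mem, mf⟩
  refine ⟨U, hD, sub_eq_iff_eq_add.2 (State.ext ?_ ?_ ?_ ?_ ?_ ?_)⟩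
  · show V.v1 = F.v1 + (V.v1 - F.v1)
    abel
  · show V.v1 - F.v1 = F.v2 + row2 U
    rw [row2, us, w1.dx_eq, ua, uw]
    match_scalars <;> field_simp <;> ring
  · show V.v3 = F.v3 + (V.v3 - F.v3)
    abel
  · show V.v3 - F.v3 = F.v4 + row4 U
    rw [row4, us, u3, w3.dx_eq]
    match_scalars <;> field_simp <;> ring
  · show V.v5 = F.v5 + (V.v5 - F.v5)
    abel
  · show V.v5 - F.v5 = F.v6 + row6 U
    rw [row6, us, w5.dx_eq]
    match_scalars <;> field_simp <;> ring

theorem isMaxDissipative_bresseOp (P : Params) : IsMaxDissipative (bresseOp P) where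
  re_inner_nonpos U := re_inner_opFun_nonpos (U : State P) U.2
  exists_sub_eq F := by
    obtain ⟨U, hU, h⟩ := exists_sub_opFun_eq F
    exact ⟨⟨U, hU⟩, h⟩

end Bresse

end

theorem mainTheorem2 (P : Bresse.Params) :
    ∃ S : ℝ≥0 → Bresse.State P →L[ℂ] Bresse.State P,
      Bresse.IsContractionSemigroup S ∧
      Bresse.IsGenerator (Bresse.bresseOp P) S ∧
      (∀ U₀ : Bresse.State P,
        Bresse.IsWeakSolution (Bresse.bresseOp P) U₀ (fun t : ℝ => S t.toNNReal U₀) ∧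
        ∀ U : ℝ → Bresse.State P, Bresse.IsWeakSolution (Bresse.bresseOp P) U₀ U →
          EqOn U (fun t : ℝ => S t.toNNReal U₀) (Ici 0)) ∧
      (∀ U₀ : Bresse.State P, U₀ ∈ (Bresse.bresseOp P).domain →
        Bresse.IsStrongSolution (Bresse.bresseOp P) U₀ (fun t : ℝ => S t.toNNReal U₀) ∧
        ∀ U : ℝ → Bresse.State P, Bresse.IsStrongSolution (Bresse.bresseOp P) U₀ U →
          EqOn U (fun t : ℝ => S t.toNNReal U₀) (Ici 0)) := by
  have hA := Bresse.isMaxDissipative_bresseOp P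
  obtain ⟨S, hS, hG⟩ := hA.exists_semigroup
  refine ⟨S, hS, hG, fun U₀ => ?_, fun U₀ hU₀ => ?_⟩
  · have h := hG.isWeakSolution hS hA U₀
    exact ⟨h, fun U hU => hA.weakSolution_unique hU h⟩
  · have h := hG.isStrongSolution hS hU₀
    exact ⟨h, fun U hU => hA.strongSolution_unique hU h⟩
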